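/- **Conventions.** A pointed digraph $\Gamma=(V\cup\{f\},E)$ is a finite directed multigraph (loops and multiple edges allowed) with one distinguished vertex $f$; $V$ is the set of its other, ordinary, vertices. It is *semistable* if every $v\in V$ has $\deg^-(v)\ge 1$, $\deg^+(v)\ge1$ and $\deg^-(v)+\deg^+(v)\ge 3$ (nothing is required of $f$), and its weight is $|E|-|V|$. Let $\dot{\mathcal G}^{ss}(j)$ be the (finite) set of isomorphism classes of semistable pointed digraphs of weight $j$. $\dot{\rm Aut}(\Gamma)$ is the group of automorphisms of $\Gamma$ fixing $f$, where an automorphism is a pair of compatible permutations of the vertices and of the edges (so parallel edges may be permuted). $\Gamma_-$ is the digraph obtained from $\Gamma$ by deleting $f$, and $A(\Gamma_-)$ is its adjacency matrix, $A_{vw}$ being the number of edges from $v$ to $w$ (the determinant of the empty matrix is $1$). Let $n\ge 0$, let $U\subset\mathbb C^n$ be open, $x\in U$, let $\Phi:U\to\mathbb R$ be smooth with $g_{i\bar j}=\partial_i\partial_{\bar j}\Phi$ positive definite on $U$, and let $f:U\to\mathbb C$ be smooth. Let $g^{i\bar j}$ be the inverse metric, $\sum_j g^{i\bar j}g_{k\bar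 j}=\delta_{ik}$, and let $L u(y)=\sum_{i,j}g^{i\bar j}(x)\,\partial_i\partial_{\bar j}u(y)$. Let $S=S(x,\cdot)$ be a complex-valued function, smooth near $x$, such that at $y=x$, with Greek indices barred or unbarred, $$S=\partial_\alpha S=\partial_{\alpha\beta}S=\partial_{i_1\cdots i_m}S=\partial_{\bar i_1\cdots\bar i_m}S=0,\qquad \partial_{i\bar j\alpha_1\cdots\alpha_m}S=-\partial_{\alpha_1\cdots\alpha_m}g_{i\bar j}(x)\quad(m\ge1).$$ These conditions prescribe the whole Taylor series of $S$ at $x$. Engliš's operators are, for $j\ge0$, $$R_jf(x)=\frac1{\det g}\sum_{k=j}^{3j}\frac1{k!\,(k-j)!}\,L^k\!\left(f\,\det g\;S^{k-j}\right)\Big|_{y=x}.$$ The Weyl invariant $\Gamma(\Phi,f)(x)$ of a pointed digraph $\Gamma$ is obtained by putting an unbarred index $a_e$ at the source and a barred index $\bar b_e$ at the target of each edge $e$, and forming $$\sum_{a,b}\ \prod_{e\in E}g^{a_e\bar b_e}(x)\ \prod_{v\in V}\Phi_v(x)\cdot f_*(x),$$ where $a,b$ run over all maps $E\to\{1,\dots,n\}$,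 $\Phi_v$ is the partial derivative of $\Phi$ along all indices placed at $v$ (for semistable $\Gamma$ it is a partial derivative $g_{i\bar j\alpha_1\cdots\alpha_m}$ of the metric, $m\ge1$), and $f_*$ is the partial derivative of $f$ along all indices placed at the distinguished vertex. It depends only on the isomorphism class of $\Gamma$. **Theorem.** Let $R_\Gamma\in\mathbb C$ be numbers indexed by the isomorphism classes $\Gamma$ of semistable pointed digraphs. Then the identity $$R_jf(x)=\sum_{\Gamma\in\dot{\mathcal G}^{ss}(j)}R_\Gamma\,\Gamma(\Phi,f)(x)$$ holds for all $j\ge 0$ and all $n,U,\Phi,f,x,S$ as above if and only if $$R_\Gamma=\frac{\det(A(\Gamma_-)-I)}{|\dot{\rm Aut}(\Gamma)|}\qquad\text{for every semistable pointed digraph }\Gamma .$$ In other words, the operators $R_j$ have a universal expansion as a sum over semistable pointed graphs, its coefficients $R_\Gamma$ are unique, and they are given by this formula. -/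

import Mathlib

open scoped ContDiff ComplexOrder

noncomputable section

namespace BerezinGraph

/-! ### Wirtinger calculus on complex coordinate space -/

/-- A coordinate index: `Sum.inl i` is the unbarred index `i` (for `∂ / ∂ zᵢ`), `Sum.inr j` is the
barred index `j` (for `∂ / ∂ z̄ⱼ`). -/
abbrev Idx (n : ℕ) : Type := Fin n ⊕ Fin n

/-- The first order Wirtinger derivatives
`∂ᵢ = (∂_{xᵢ} - √-1 ∂_{yᵢ}) / 2` and `∂̄ᵢ = (∂_{xᵢ} + √-1 ∂_{yᵢ}) / 2`, where `zᵢ = xᵢ + √-1 yᵢ`. -/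
def wirt {n : ℕ} : Idx n → ((Fin n → ℂ) → ℂ) → (Fin n → ℂ) → ℂ
  | Sum.inl i, u => fun z =>
      (fderiv ℝ u z (Pi.single i 1) - Complex.I * fderiv ℝ u z (Pi.single i Complex.I)) / 2
  | Sum.inr i, u => fun z =>
      (fderiv ℝ u z (Pi.single i 1) + Complex.I * fderiv ℝ u z (Pi.single i Complex.I)) / 2

/-- Iterated Wirtinger derivatives `∂_{α₁} ∂_{α₂} ⋯ ∂_{αₘ} u`, each `αᵢ` barred or unbarred. -/
def wirtList {n : ℕ} (l : List (Idx n)) (u : (Fin n → ℂ) → ℂ) : (Fin n → ℂ) → ℂ :=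
  l.foldr wirt u

/-- The iterated Wirtinger derivative along a multiset of indices. On smooth functions the order of
differentiation is immaterial, so any listing of the multiset gives the same value. -/
def wirtMultiset {n : ℕ} (s : Multiset (Idx n)) (u : (Fin n → ℂ) → ℂ) : (Fin n → ℂ) → ℂ :=
  wirtList s.toList u

/-! ### Kähler metrics and the operators `R_j` -/

/-- The metric `g_{i j̄} = ∂ᵢ ∂̄ⱼ Φ` at the point `z`; row `i` is the unbarred index. -/
def metric {n : ℕ} (Φ : (Fin n → ℂ) → ℝ) (z : Fin n → ℂ) : Matrix (Fin n) (Fin n) ℂ :=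
  Matrix.of fun i j => wirtList [Sum.inl i, Sum.inr j] (fun w => (Φ w : ℂ)) z

/-- The inverse metric `g^{i j̄}`, normalized by `∑ⱼ g^{i j̄} g_{k j̄} = δᵢₖ`. -/
def invMetric {n : ℕ} (Φ : (Fin n → ℂ) → ℝ) (z : Fin n → ℂ) (i j : Fin n) : ℂ :=
  (metric Φ z)⁻¹ j i

/-- `Φ` is a smooth Kähler potential on the set `U` (open, in all uses). -/
structure IsKahlerPotential {n : ℕ} (Φ : (Fin n → ℂ) → ℝ) (U : Set (Fin n → ℂ)) : Prop where
  smooth : ContDiffOn ℝ ∞ Φ U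
  posDef : ∀ z ∈ U, (metric Φ z).PosDef

/-- `S = S(x, ·)` is smooth at `x` and has at `x` the derivatives of the remainder in the phase:
`S = ∂_α S = ∂_{αβ} S = 0`, all purely holomorphic and purely antiholomorphic derivatives vanish,
and `∂_{i j̄ α₁ ⋯ αₘ} S = - ∂_{α₁ ⋯ αₘ} g_{i j̄}` for `m ≥ 1`. These conditions prescribe the
full Taylor series of `S` at `x`. -/
structure IsPhaseRemainder {n : ℕ} (Φ : (Fin n → ℂ) → ℝ) (x : Fin n → ℂ)
    (S : (Fin n → ℂ) → ℂ) : Prop where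
  smooth : ContDiffAt ℝ ∞ S x
  low : ∀ l : List (Idx n), l.length ≤ 2 → wirtList l S x = 0
  holomorphic : ∀ l : List (Fin n), wirtList (l.map Sum.inl) S x = 0
  antiholomorphic : ∀ l : List (Fin n), wirtList (l.map Sum.inr) S x = 0
  mixed : ∀ (l : List (Idx n)) (i j : Fin n), l ≠ [] →
    wirtList (l ++ [Sum.inl i, Sum.inr j]) S x = - wirtList l (fun y => metric Φ y i j) x

/-- The operator `L u (y) = ∑ g^{i j̄}(x) ∂ᵢ ∂̄ⱼ u (y)`, with coefficients frozen at `x`. -/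
def frozenLaplacian {n : ℕ} (Φ : (Fin n → ℂ) → ℝ) (x : Fin n → ℂ) (u : (Fin n → ℂ) → ℂ) :
    (Fin n → ℂ) → ℂ :=
  fun y => ∑ i, ∑ j, invMetric Φ x i j * wirtList [Sum.inl i, Sum.inr j] u y

/-- Engliš's operators
`R_j f (x) = (1 / det g) ∑_{k=j}^{3j} 1 / (k! (k-j)!) L^k (f det g S^{k-j}) |_{y = x}`. -/
def englisR {n : ℕ} (Φ : (Fin n → ℂ) → ℝ) (S : (Fin n → ℂ) → ℂ) (j : ℕ)
    (f : (Fin n → ℂ) → ℂ) (x : Fin n → ℂ) : ℂ :=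
  ((metric Φ x).det)⁻¹ * ∑ k ∈ Finset.Icc j (3 * j),
    ((k.factorial : ℂ) * ((k - j).factorial : ℂ))⁻¹ *
      (frozenLaplacian Φ x)^[k] (fun y => f y * (metric Φ y).det * S y ^ (k - j)) x

/-! ### Pointed digraphs -/

/-- A finite pointed digraph `Γ = (V ∪ {f}, E)`, loops and multiple edges allowed. The ordinary
vertices are `some v` with `v : Fin numV`, the distinguished vertex `f` is `none`, and every
edge `e : Fin numE` runs from `src e` to `tgt e`. -/
structure PointedDigraph where
  numV : ℕ
  numE : ℕ
  src : Fin numE → Option (Fin numV)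
  tgt : Fin numE → Option (Fin numV)

namespace PointedDigraph

/-- Isomorphisms of pointed digraphs: bijections of the ordinary vertices and of the edges that
preserve sources and targets; the distinguished vertex is sent to the distinguished vertex. -/
@[ext]
structure Iso (Γ Δ : PointedDigraph) where
  vert : Fin Γ.numV ≃ Fin Δ.numV
  edge : Fin Γ.numE ≃ Fin Δ.numE
  src_edge : ∀ e, Δ.src (edge e) = (Γ.src e).map vert
  tgt_edge : ∀ e, Δ.tgt (edge e) = (Γ.tgt e).map vert

/-- Automorphisms of `Γ` as a pointed digraph. Parallel edges may be permuted, so that the graph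
with only the vertex `f` and `k` loops at it has `k!` automorphisms. -/
abbrev Aut (Γ : PointedDigraph) : Type := Iso Γ Γ

/-- `Γ` and `Δ` are isomorphic. -/
instance isoSetoid : Setoid PointedDigraph where
  r Γ Δ := Nonempty (Iso Γ Δ)
  iseqv :=
    { refl := fun Γ => ⟨⟨Equiv.refl _, Equiv.refl _, fun e => by simp, fun e => by simp⟩⟩
      symm := by
        rintro Γ Δ ⟨h⟩
        refine ⟨⟨h.vert.symm, h.edge.symm, fun e => ?_, fun e => ?_⟩⟩
        · have := h.src_edge (h.edge.symm e)
          rw [Equiv.apply_symm_apply] at this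
          rw [this, Option.map_map]; simp
        · have := h.tgt_edge (h.edge.symm e)
          rw [Equiv.apply_symm_apply] at this
          rw [this, Option.map_map]; simp
      trans := by
        rintro Γ Δ Θ ⟨h⟩ ⟨k⟩
        refine ⟨⟨h.vert.trans k.vert, h.edge.trans k.edge, fun e => ?_, fun e => ?_⟩⟩
        · simp [k.src_edge, h.src_edge, Option.map_map]
        · simp [k.tgt_edge, h.tgt_edge, Option.map_map] }

/-- Isomorphism classes of finite pointed digraphs. -/
abbrev IsoClass : Type := Quotient isoSetoid

/-- The outdegree of a vertex. -/
def outDeg (Γ : PointedDigraph) (v : Option (Fin Γ.numV)) : ℕ :=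
  (Finset.univ.filter fun e => Γ.src e = v).card

/-- The indegree of a vertex. -/
def inDeg (Γ : PointedDigraph) (v : Option (Fin Γ.numV)) : ℕ :=
  (Finset.univ.filter fun e => Γ.tgt e = v).card

/-- Every ordinary vertex has indegree at least `1`, outdegree at least `1` and total degree at
least `3`; nothing is required of the distinguished vertex. -/
def IsSemistable (Γ : PointedDigraph) : Prop :=
  ∀ v : Fin Γ.numV, 1 ≤ Γ.inDeg (some v) ∧ 1 ≤ Γ.outDeg (some v) ∧
    3 ≤ Γ.inDeg (some v) + Γ.outDeg (some v)

/-- The weight `|E| - |V|`, where `V` is the set of ordinary vertices. -/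
def weight (Γ : PointedDigraph) : ℤ := (Γ.numE : ℤ) - (Γ.numV : ℤ)

/-- The adjacency matrix `A(Γ₋)` of the digraph `Γ₋` obtained by removing `f` from `Γ`. -/
def adjMinus (Γ : PointedDigraph) : Matrix (Fin Γ.numV) (Fin Γ.numV) ℤ :=
  Matrix.of fun v w =>
    ((Finset.univ.filter fun e => Γ.src e = some v ∧ Γ.tgt e = some w).card : ℤ)

/-- The indices put on the half-edges at the vertex `v` when the edge `e` carries the unbarred
index `a e` at its source and the barred index `b e` at its target. -/
def halfEdges (Γ : PointedDigraph) {n : ℕ} (a b : Fin Γ.numE → Fin n)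
    (v : Option (Fin Γ.numV)) : Multiset (Idx n) :=
  ((Finset.univ.filter fun e => Γ.src e = v).val.map fun e => Sum.inl (a e)) +
    ((Finset.univ.filter fun e => Γ.tgt e = v).val.map fun e => Sum.inr (b e))

/-- The Weyl invariant of `Γ` at `x`: an ordinary vertex `v` contributes the derivative of the
metric `g_{i j̄ α}` whose unbarred (barred) indices are the outgoing (incoming) half-edges at `v`;
since `g_{i j̄ α} = ∂_α ∂ᵢ ∂̄ⱼ Φ`, this is the derivative of `Φ` along all half-edges at `v`.
The distinguished vertex contributes the derivative of `f` along its half-edges, and each edge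
contracts its two indices with the inverse metric. -/
def weyl (Γ : PointedDigraph) {n : ℕ} (Φ : (Fin n → ℂ) → ℝ) (f : (Fin n → ℂ) → ℂ)
    (x : Fin n → ℂ) : ℂ :=
  ∑ a : Fin Γ.numE → Fin n, ∑ b : Fin Γ.numE → Fin n,
    (∏ e, invMetric Φ x (a e) (b e)) *
      (∏ v : Fin Γ.numV,
        wirtMultiset (Γ.halfEdges a b (some v)) (fun w => (Φ w : ℂ)) x) *
      wirtMultiset (Γ.halfEdges a b none) f x

theorem halfEdges_iso {Γ Δ : PointedDigraph} (h : Iso Γ Δ) {n : ℕ} (a b : Fin Δ.numE → Fin n)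
    (v : Option (Fin Γ.numV)) :
    Γ.halfEdges (a ∘ h.edge) (b ∘ h.edge) v = Δ.halfEdges a b (v.map h.vert) := by
  have inj := Option.map_injective h.vert.injective
  have h1 : (Finset.univ.filter fun e => Δ.src e = v.map h.vert) =
      (Finset.univ.filter fun e => Γ.src e = v).map h.edge.toEmbedding := by
    ext e
    obtain ⟨e, rfl⟩ := h.edge.surjective e
    simp [h.src_edge, inj.eq_iff]
  have h2 : (Finset.univ.filter fun e => Δ.tgt e = v.map h.vert) =
      (Finset.univ.filter fun e => Γ.tgt e = v).map h.edge.toEmbedding := by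
    ext e
    obtain ⟨e, rfl⟩ := h.edge.surjective e
    simp [h.tgt_edge, inj.eq_iff]
  unfold halfEdges
  rw [h1, h2]
  simp [Finset.map_val, Multiset.map_map]

/-- Isomorphic pointed digraphs have the same Weyl invariant. -/
theorem weyl_iso {Γ Δ : PointedDigraph} (h : Iso Γ Δ) {n : ℕ} (Φ : (Fin n → ℂ) → ℝ)
    (f : (Fin n → ℂ) → ℂ) (x : Fin n → ℂ) : Γ.weyl Φ f x = Δ.weyl Φ f x := by
  unfold weyl
  refine Fintype.sum_equiv (h.edge.arrowCongr (Equiv.refl _)) _ _ fun a => ?_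
  refine Fintype.sum_equiv (h.edge.arrowCongr (Equiv.refl _)) _ _ fun b => ?_
  obtain ⟨a, rfl⟩ := (h.edge.arrowCongr (Equiv.refl (Fin n))).symm.surjective a
  obtain ⟨b, rfl⟩ := (h.edge.arrowCongr (Equiv.refl (Fin n))).symm.surjective b
  simp only [Equiv.apply_symm_apply]
  have ha : (h.edge.arrowCongr (Equiv.refl (Fin n))).symm a = a ∘ h.edge := rfl
  have hb : (h.edge.arrowCongr (Equiv.refl (Fin n))).symm b = b ∘ h.edge := rfl
  rw [ha, hb]
  congr 1
  · congr 1
    · exact Fintype.prod_equiv h.edge _ _ fun e => rfl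
    · refine Fintype.prod_equiv h.vert _ _ fun v => ?_
      rw [halfEdges_iso]; rfl
  · rw [halfEdges_iso]; rfl

/-- The Weyl invariant of an isomorphism class of pointed digraphs. -/
def IsoClass.weyl {n : ℕ} (Φ : (Fin n → ℂ) → ℝ) (f : (Fin n → ℂ) → ℂ) (x : Fin n → ℂ)
    (q : IsoClass) : ℂ :=
  Quotient.lift (s := isoSetoid) (fun Γ : PointedDigraph => Γ.weyl Φ f x)
    (fun Γ Δ (h : Nonempty (Iso Γ Δ)) => h.elim fun i => weyl_iso i Φ f x) q

theorem sum_outDeg_le (Γ : PointedDigraph) :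
    ∑ v : Fin Γ.numV, Γ.outDeg (some v) ≤ Γ.numE := by
  unfold outDeg
  rw [← Finset.card_biUnion]
  · simpa using Finset.card_le_univ (Finset.univ.biUnion fun v : Fin Γ.numV =>
      Finset.univ.filter fun e => Γ.src e = some v)
  · intro v _ w _ hvw
    refine Finset.disjoint_filter.2 fun e _ h1 h2 => hvw ?_
    simpa using h1.symm.trans h2

theorem sum_inDeg_le (Γ : PointedDigraph) :
    ∑ v : Fin Γ.numV, Γ.inDeg (some v) ≤ Γ.numE := by
  unfold inDeg
  rw [← Finset.card_biUnion]
  · simpa using Finset.card_le_univ (Finset.univ.biUnion fun v : Fin Γ.numV =>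
      Finset.univ.filter fun e => Γ.tgt e = some v)
  · intro v _ w _ hvw
    refine Finset.disjoint_filter.2 fun e _ h1 h2 => hvw ?_
    simpa using h1.symm.trans h2

theorem IsSemistable.three_mul_numV_le {Γ : PointedDigraph} (h : Γ.IsSemistable) :
    3 * Γ.numV ≤ 2 * Γ.numE := by
  have h3 : ∑ v : Fin Γ.numV, 3 ≤
      ∑ v : Fin Γ.numV, (Γ.inDeg (some v) + Γ.outDeg (some v)) :=
    Finset.sum_le_sum fun v _ => (h v).2.2
  rw [Finset.sum_add_distrib] at h3
  simp at h3
  have := Γ.sum_outDeg_le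
  have := Γ.sum_inDeg_le
  omega

/-- There are only finitely many isomorphism classes of semistable pointed digraphs of a given
weight. -/
theorem finite_semistable (k : ℕ) :
    {q : IsoClass | ∃ Γ : PointedDigraph, Γ.IsSemistable ∧ Γ.weight = k ∧ ⟦Γ⟧ = q}.Finite := by
  let T : Type := Σ p : Fin (2 * k + 1) × Fin (3 * k + 1),
    (Fin p.2 → Option (Fin p.1)) × (Fin p.2 → Option (Fin p.1))
  let F : T → IsoClass := fun t => ⟦⟨t.1.1, t.1.2, t.2.1, t.2.2⟩⟧
  refine (Set.finite_range F).subset ?_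
  rintro q ⟨⟨v, e, s, t⟩, hs, hw, rfl⟩
  have h := hs.three_mul_numV_le
  simp only [weight] at hw h
  exact ⟨⟨(⟨v, by omega⟩, ⟨e, by omega⟩), (s, t)⟩, rfl⟩

/-- The set of isomorphism classes of pointed semistable graphs of weight `k`. -/
def semistableClasses (k : ℕ) : Finset IsoClass := (finite_semistable k).toFinset

end PointedDigraph

end BerezinGraph

end

/-!
The operator `L ^ k`, having constant coefficients, acts on a product of functions by the general
Leibniz rule: it distributes `k` contracted pairs of derivatives over the factors in all possible
ways, so it is a sum over all digraphs with `k` labelled edges whose vertices are the factors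
(`frozenLaplacian_iterate_prod`). The factors of `R_j` are of three kinds. The function `f` is the
distinguished vertex. Each factor `S` is an ordinary vertex with the weight `-Φ_v`, and the
derivatives of `S` that are required to vanish are those that would give a vertex that is not semistable
(`wirtMultiset_phaseRemainder`). Finally
`det g(y) / det g(x) = det (1 + N(y))` with `N(y) = g(x)⁻¹ (g(y) - g(x))`, which
`det_one_add_eq_sum` expands into signed permutations of labelled vertices; the vertex `v` carries
`g_{i j̄}(y) - g_{i j̄}(x)`, and the inverse metric in `N` supplies for each `v` an additional edge
along the cycles of the permutation. This is `englisR_eq_sum`.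

So a labelled digraph occurs in `R_j` once for every set of disjoint directed cycles chosen in it, with
the sign of the permutation for the vertices on the cycles and `-1` for each other vertex. By the same
determinant expansion, applied to the adjacency matrix, these signs add up to `det (A(Γ₋) - 1)`
(`sum_det_sub_one_mul_jetWeyl`). The factorials in `R_j` turn the sum over labelled digraphs into a sum
over isomorphism classes weighted by `1 / |Aut Γ|`
(`PointedDigraph.sum_semistableClasses_eq`), which gives `englisR_eq_sum_coeff`.

For uniqueness the Weyl invariants of a given weight have to be linearly independent
(`PointedDigraph.eq_zero_of_sum_weyl_eq_zero`). Take a digraph `Γ₀` with as many vertices as possible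
among those with a nonzero coefficient, use its edges as coordinates, let `f` be the monomial of the
half-edges at the distinguished vertex, and let `Φ = |z|² + 2 Re ∑_v t_v M_v`, where `M_v` is the
monomial of the half-edges at `v`. The metric is the identity at the origin, and each edge label occurs
exactly once as a source and once as a target, so, for `Γ` of the same weight with no more vertices than
`Γ₀`, the coefficient of `∏ t_v` in the Weyl invariant of `Γ` counts the isomorphisms from `Γ` to `Γ₀`.
As `Φ` is real, the `t̄_v` occur as well; summing over cube roots of unity `t_v` separates them from the `t_v` (`sum_prod_cubeChar`).
-/

namespace BerezinGraph

open Filter Topology Finset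

/-! ### Wirtinger calculus at a point -/

/-- The coordinate `i` of an index `i` or `ī`. -/
def Idx.coord {n : ℕ} : Idx n → Fin n := Sum.elim id id

/-- The coefficient `∓√-1` of `∂_y` in the Wirtinger derivative. -/
def Idx.twist {n : ℕ} : Idx n → ℂ := Sum.elim (fun _ => -Complex.I) (fun _ => Complex.I)

section Wirtinger

variable {n : ℕ} {x : Fin n → ℂ} {u v : (Fin n → ℂ) → ℂ}

theorem wirt_apply (α : Idx n) (u : (Fin n → ℂ) → ℂ) (z : Fin n → ℂ) :
    wirt α u z = (fderiv ℝ u z (Pi.single α.coord 1) +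
      α.twist * fderiv ℝ u z (Pi.single α.coord Complex.I)) / 2 := by
  cases α <;> simp [wirt, Idx.coord, Idx.twist, sub_eq_add_neg]

theorem contDiffAt_wirt (hu : ContDiffAt ℝ ∞ u x) (α : Idx n) :
    ContDiffAt ℝ ∞ (wirt α u) x := by
  have h : ContDiffAt ℝ ∞ (fderiv ℝ u) x := hu.fderiv_right (by simp)
  have : wirt α u = fun z => (fderiv ℝ u z (Pi.single α.coord 1) +
      α.twist * fderiv ℝ u z (Pi.single α.coord Complex.I)) / 2 := funext (wirt_apply α u)
  rw [this]
  exact ((h.clm_apply contDiffAt_const).add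
    (contDiffAt_const.mul (h.clm_apply contDiffAt_const))).div_const _

theorem contDiffAt_wirtList (hu : ContDiffAt ℝ ∞ u x) (l : List (Idx n)) :
    ContDiffAt ℝ ∞ (wirtList l u) x := by
  induction l with
  | nil => exact hu
  | cons α l ih => exact contDiffAt_wirt ih α

theorem contDiffAt_wirtMultiset (hu : ContDiffAt ℝ ∞ u x) (s : Multiset (Idx n)) :
    ContDiffAt ℝ ∞ (wirtMultiset s u) x :=
  contDiffAt_wirtList hu _

theorem eventually_differentiableAt (hu : ContDiffAt ℝ ∞ u x) :
    ∀ᶠ y in 𝓝 x, DifferentiableAt ℝ u y :=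
  ((hu.of_le (m := 1) (by simp)).eventually (by simp)).mono fun _ hy => hy.differentiableAt (by simp)

theorem wirt_congr (h : u =ᶠ[𝓝 x] v) (α : Idx n) : wirt α u =ᶠ[𝓝 x] wirt α v := by
  filter_upwards [h.eventuallyEq_nhds] with y hy
  rw [wirt_apply, wirt_apply, hy.fderiv_eq]

theorem wirtList_congr (h : u =ᶠ[𝓝 x] v) (l : List (Idx n)) :
    wirtList l u =ᶠ[𝓝 x] wirtList l v := by
  induction l with
  | nil => exact h
  | cons α l ih => exact wirt_congr ih α

theorem wirt_sum {κ : Type*} (s : Finset κ) (F : κ → (Fin n → ℂ) → ℂ)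
    (hF : ∀ i ∈ s, ContDiffAt ℝ ∞ (F i) x) (α : Idx n) :
    wirt α (fun y => ∑ i ∈ s, F i y) =ᶠ[𝓝 x] fun y => ∑ i ∈ s, wirt α (F i) y := by
  have : ∀ᶠ y in 𝓝 x, ∀ i ∈ s, DifferentiableAt ℝ (F i) y :=
    (s.eventually_all).2 fun i hi => eventually_differentiableAt (hF i hi)
  filter_upwards [this] with y hy
  simp only [wirt_apply]
  rw [fderiv_fun_sum hy]
  simp only [_root_.sum_apply, ← Finset.sum_div, Finset.mul_sum,
    Finset.sum_add_distrib]

theorem wirtList_sum {κ : Type*} (s : Finset κ) (F : κ → (Fin n → ℂ) → ℂ)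
    (hF : ∀ i ∈ s, ContDiffAt ℝ ∞ (F i) x) (l : List (Idx n)) :
    wirtList l (fun y => ∑ i ∈ s, F i y) =ᶠ[𝓝 x] fun y => ∑ i ∈ s, wirtList l (F i) y := by
  induction l with
  | nil => exact EventuallyEq.rfl
  | cons α l ih =>
    exact (wirt_congr ih α).trans
      (wirt_sum s (fun i => wirtList l (F i)) (fun i hi => contDiffAt_wirtList (hF i hi) l) α)

theorem wirt_const_mul (c : ℂ) (hu : ContDiffAt ℝ ∞ u x) (α : Idx n) :
    wirt α (fun y => c * u y) =ᶠ[𝓝 x] fun y => c * wirt α u y := by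
  filter_upwards [eventually_differentiableAt hu] with y hy
  simp only [wirt_apply]
  rw [fderiv_const_mul hy]
  simp only [_root_.smul_apply, smul_eq_mul]
  ring

theorem wirtList_const_mul (c : ℂ) (hu : ContDiffAt ℝ ∞ u x) (l : List (Idx n)) :
    wirtList l (fun y => c * u y) =ᶠ[𝓝 x] fun y => c * wirtList l u y := by
  induction l with
  | nil => exact EventuallyEq.rfl
  | cons α l ih => exact (wirt_congr ih α).trans (wirt_const_mul c (contDiffAt_wirtList hu l) α)

theorem wirt_prod {ι : Type*} [DecidableEq ι] (s : Finset ι) (F : ι → (Fin n → ℂ) → ℂ)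
    (hF : ∀ i ∈ s, ContDiffAt ℝ ∞ (F i) x) (α : Idx n) :
    wirt α (fun y => ∏ i ∈ s, F i y) =ᶠ[𝓝 x]
      fun y => ∑ i ∈ s, (∏ j ∈ s.erase i, F j y) * wirt α (F i) y := by
  have : ∀ᶠ y in 𝓝 x, ∀ i ∈ s, DifferentiableAt ℝ (F i) y :=
    (s.eventually_all).2 fun i hi => eventually_differentiableAt (hF i hi)
  filter_upwards [this] with y hy
  simp only [wirt_apply]
  rw [(HasFDerivAt.finsetProd fun i hi => (hy i hi).hasFDerivAt).fderiv]
  simp only [_root_.sum_apply, _root_.smul_apply, smul_eq_mul,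
    Finset.mul_sum, ← Finset.sum_add_distrib, Finset.sum_div]
  refine Finset.sum_congr rfl fun i _ => ?_
  ring

theorem wirt_const (c : ℂ) (α : Idx n) : wirt α (fun _ : Fin n → ℂ => c) = fun _ => 0 := by
  funext y
  simp [wirt_apply]

theorem wirtList_const (c : ℂ) (l : List (Idx n)) (hl : l ≠ []) :
    wirtList l (fun _ : Fin n → ℂ => c) = fun _ => 0 := by
  induction l with
  | nil => exact absurd rfl hl
  | cons α l ih =>
    change wirt α (wirtList l _) = _
    rcases eq_or_ne l [] with rfl | h
    · exact wirt_const c α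
    · rw [ih h, wirt_const]

theorem fderiv_wirt (hu : ContDiffAt ℝ 2 u x) (α : Idx n) (w : Fin n → ℂ) :
    fderiv ℝ (wirt α u) x w = (fderiv ℝ (fderiv ℝ u) x w (Pi.single α.coord 1) +
      α.twist * fderiv ℝ (fderiv ℝ u) x w (Pi.single α.coord Complex.I)) / 2 := by
  have hd : DifferentiableAt ℝ (fderiv ℝ u) x :=
    (hu.fderiv_right (m := 1) (by norm_num)).differentiableAt (by simp)
  have h1 : ∀ c : Fin n → ℂ, HasFDerivAt (fun z => fderiv ℝ u z c)
      ((fderiv ℝ (fderiv ℝ u) x).flip c) x := fun c => by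
    simpa using hd.hasFDerivAt.clm_apply (hasFDerivAt_const c x)
  have h2 := (((h1 (Pi.single α.coord 1)).add
    ((h1 (Pi.single α.coord Complex.I)).const_mul α.twist)).mul_const (2⁻¹ : ℂ))
  have h3 : wirt α u = fun z => (fderiv ℝ u z (Pi.single α.coord 1) +
      α.twist * fderiv ℝ u z (Pi.single α.coord Complex.I)) * 2⁻¹ := by
    funext z
    rw [wirt_apply, div_eq_mul_inv]
  rw [h3]
  erw [h2.fderiv]
  simp
  ring

theorem wirt_comm (hu : ContDiffAt ℝ ∞ u x) (α β : Idx n) :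
    wirt α (wirt β u) =ᶠ[𝓝 x] wirt β (wirt α u) := by
  have h2 : ContDiffAt ℝ 2 u x := hu.of_le (WithTop.coe_le_coe.2 (le_top (a := (2 : ℕ∞))))
  filter_upwards [h2.eventually (by simp)] with y hy
  have hs : ∀ a b, fderiv ℝ (fderiv ℝ u) y a b = fderiv ℝ (fderiv ℝ u) y b a := fun a b =>
    (hy.isSymmSndFDerivAt (by simp)) a b
  rw [wirt_apply, wirt_apply]
  simp only [fderiv_wirt hy]
  rw [hs (Pi.single α.coord 1) (Pi.single β.coord 1),
    hs (Pi.single α.coord 1) (Pi.single β.coord Complex.I),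
    hs (Pi.single α.coord Complex.I) (Pi.single β.coord 1),
    hs (Pi.single α.coord Complex.I) (Pi.single β.coord Complex.I)]
  ring

theorem wirtList_perm (hu : ContDiffAt ℝ ∞ u x) {l l' : List (Idx n)} (h : l.Perm l') :
    wirtList l u =ᶠ[𝓝 x] wirtList l' u := by
  induction h with
  | nil => exact EventuallyEq.rfl
  | cons α _ ih => exact wirt_congr ih α
  | swap α β l => exact wirt_comm (contDiffAt_wirtList hu l) β α
  | trans _ _ ih ih' => exact ih.trans ih'

theorem wirtMultiset_coe (hu : ContDiffAt ℝ ∞ u x) (l : List (Idx n)) :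
    wirtMultiset (l : Multiset (Idx n)) u =ᶠ[𝓝 x] wirtList l u :=
  wirtList_perm hu (Multiset.coe_eq_coe.1 (Multiset.coe_toList _))

theorem wirtMultiset_cons (hu : ContDiffAt ℝ ∞ u x) (α : Idx n) (s : Multiset (Idx n)) :
    wirtMultiset (α ::ₘ s) u =ᶠ[𝓝 x] wirt α (wirtMultiset s u) := by
  induction s using Quotient.inductionOn with
  | _ l =>
    exact (wirtMultiset_coe hu (α :: l)).trans (wirt_congr (wirtMultiset_coe hu l).symm α)

@[simp]
theorem wirtMultiset_zero (u : (Fin n → ℂ) → ℂ) : wirtMultiset 0 u = u := by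
  simp [wirtMultiset, wirtList]

theorem wirtList_append (l l' : List (Idx n)) (u : (Fin n → ℂ) → ℂ) :
    wirtList (l ++ l') u = wirtList l (wirtList l' u) := by
  simp [wirtList]

theorem map_filter_piOption {H ι κ : Type*} [Fintype H] [DecidableEq H] [DecidableEq ι]
    (lab : Option H → κ) (i j : ι) (c : H → ι) :
    (univ.filter fun e => (Equiv.piOptionEquivProd (β := fun _ => ι)).symm (i, c) e = j).val.map
        lab =
      if i = j then lab none ::ₘ (univ.filter fun e => c e = j).val.map (lab ∘ some)
        else (univ.filter fun e => c e = j).val.map (lab ∘ some) := by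
  have : (univ.filter fun e => (Equiv.piOptionEquivProd (β := fun _ => ι)).symm (i, c) e = j) =
      if i = j then insertNone (univ.filter fun e => c e = j)
      else (univ.filter fun e => c e = j).map Function.Embedding.some := by
    ext o
    rw [Finset.mem_filter]
    cases o <;> split_ifs with h <;> simp [h, Equiv.piOptionEquivProd, eq_comm]
  rw [this]
  split_ifs with h
  · simp [Finset.insertNone, Multiset.map_map, Finset.map_val, Function.comp_def]
  · simp [Multiset.map_map, Finset.map_val, Function.comp_def]

/-- The general Leibniz rule: the derivative of a product along a family of indices is the sum over
all ways to distribute the indices among the factors. -/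
theorem wirtMultiset_prod {ι : Type*} [Fintype ι] [DecidableEq ι]
    (F : ι → (Fin n → ℂ) → ℂ) (hF : ∀ i, ContDiffAt ℝ ∞ (F i) x)
    {H : Type} [Fintype H] [DecidableEq H] (lab : H → Idx n) :
    wirtMultiset ((univ : Finset H).val.map lab) (fun y => ∏ i, F i y) =ᶠ[𝓝 x]
      fun y => ∑ c : H → ι, ∏ i,
        wirtMultiset ((univ.filter fun e => c e = i).val.map lab) (F i) y := by
  have hprod : ContDiffAt ℝ ∞ (fun y => ∏ i, F i y) x := contDiffAt_prod fun i _ => hF i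
  let P : (H : Type) → [Fintype H] → Prop := fun H _ => ∀ (_ : DecidableEq H) (lab : H → Idx n),
    wirtMultiset ((univ : Finset H).val.map lab) (fun y => ∏ i, F i y) =ᶠ[𝓝 x]
      fun y => ∑ c : H → ι, ∏ i,
        wirtMultiset ((univ.filter fun e => c e = i).val.map lab) (F i) y
  suffices h : P H from h inferInstance lab
  refine @Fintype.induction_empty_option P ?_ ?_ ?_ H _
  · intro A B _ e ih _ lab
    let := Fintype.ofEquiv B e.symm
    let : DecidableEq A := e.decidableEq
    have h1 : (univ : Finset B) = (univ : Finset A).map e.toEmbedding := by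
      ext b; simp
    have h2 := ih inferInstance (lab ∘ e)
    have h3 : ((univ : Finset B).val.map lab) = ((univ : Finset A).val.map (lab ∘ e)) := by
      rw [h1, Finset.map_val, Multiset.map_map]; rfl
    rw [h3]
    refine EventuallyEq.trans h2 (Eq.eventuallyEq ?_)
    funext y
    refine Fintype.sum_equiv (e.arrowCongr (Equiv.refl ι)) _ _ fun c => ?_
    refine Finset.prod_congr rfl fun i _ => ?_
    have h4 : (univ.filter fun b => (e.arrowCongr (Equiv.refl ι)) c b = i) =
        (univ.filter fun a => c a = i).map e.toEmbedding := by
      ext b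
      obtain ⟨a, rfl⟩ := e.surjective b
      simp [Equiv.arrowCongr]
    rw [h4, Finset.map_val, Multiset.map_map]
    rfl
  · intro _ lab
    simp
  · intro A _ ih _ lab
    classical
    have hU : ((univ : Finset (Option A)).val.map lab) =
        lab none ::ₘ ((univ : Finset A).val.map (lab ∘ some)) := by
      simp [univ_option, Finset.insertNone, Multiset.map_map, Finset.map_val]
    rw [hU]
    refine (wirtMultiset_cons hprod _ _).trans
      ((wirt_congr (ih (Classical.decEq A) (lab ∘ some)) _).trans ?_)
    have hs : ∀ (c : A → ι) (i : ι), ContDiffAt ℝ ∞ (wirtMultiset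
        ((univ.filter fun e => c e = i).val.map (lab ∘ some)) (F i)) x := fun c i =>
      contDiffAt_wirtMultiset (hF i) _
    refine (wirt_sum univ _ (fun c _ => contDiffAt_prod fun i _ => hs c i) _).trans ?_
    have h1 : ∀ᶠ y in 𝓝 x, ∀ c : A → ι, _ := eventually_all.2 fun c : A → ι =>
      wirt_prod univ _ (fun i _ => hs c i) (lab none)
    have h2 : ∀ᶠ y in 𝓝 x, ∀ c : A → ι, ∀ i : ι,
        wirtMultiset (lab none ::ₘ (univ.filter fun e => c e = i).val.map (lab ∘ some)) (F i) y =
        wirt (lab none) (wirtMultiset ((univ.filter fun e => c e = i).val.map (lab ∘ some))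
          (F i)) y :=
      eventually_all.2 fun c => eventually_all.2 fun i => wirtMultiset_cons (hF i) _ _
    filter_upwards [h1, h2] with y hy1 hy2
    rw [Finset.sum_congr rfl fun c _ => hy1 c]
    have hre : ∀ G : (Option A → ι) → ℂ, ∑ c, G c = ∑ c : A → ι, ∑ i,
        G ((Equiv.piOptionEquivProd (β := fun _ => ι)).symm (i, c)) := fun G => by
      rw [← (Equiv.piOptionEquivProd (β := fun _ => ι)).symm.sum_comp, Fintype.sum_prod_type_right]
    rw [hre]
    refine Finset.sum_congr (by congr!) fun c _ => Finset.sum_congr rfl fun i _ => ?_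
    rw [← hy2 c i, mul_comm, ← Finset.mul_prod_erase univ _ (mem_univ i)]
    congr 1
    · rw [map_filter_piOption, if_pos rfl]
    · refine Finset.prod_congr rfl fun j hj => ?_
      rw [map_filter_piOption, if_neg (Finset.ne_of_mem_erase hj).symm]

end Wirtinger

/-! ### Iterates of the frozen Laplacian -/

section Laplacian

theorem sum_arrow_sum {A B C M : Type*} [Fintype A] [Fintype B] [Fintype C] [DecidableEq A]
    [DecidableEq B] [AddCommMonoid M] (F : (A ⊕ B → C) → M) :
    ∑ f, F f = ∑ a : A → C, ∑ b : B → C, F (Sum.elim a b) := by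
  rw [← (Equiv.sumArrowEquivProdArrow A B C).symm.sum_comp, Fintype.sum_prod_type]
  rfl

theorem sum_fin_succ_arrow {k : ℕ} {C M : Type*} [Fintype C] [AddCommMonoid M]
    (F : (Fin (k + 1) → C) → M) :
    ∑ f, F f = ∑ c, ∑ a : Fin k → C, F (Fin.cons c a) := by
  rw [← (Fin.consEquiv fun _ => C).sum_comp, Fintype.sum_prod_type]
  rfl

theorem map_univ_sumMap {A B C D : Type*} [Fintype A] [Fintype B] (a : A → C) (b : B → D) :
    (univ : Finset (A ⊕ B)).val.map (Sum.map a b) =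
      (univ : Finset A).val.map (fun e => Sum.inl (a e)) +
        (univ : Finset B).val.map (fun e => Sum.inr (b e)) := by
  rw [← Finset.univ_disjSum_univ, Finset.val_disjSum, Multiset.disjSum, Multiset.map_add,
    Multiset.map_map, Multiset.map_map]
  rfl

theorem map_univ_cons {k : ℕ} {C D : Type*} (f : C → D) (c : C) (a : Fin k → C) :
    (univ : Finset (Fin (k + 1))).val.map (fun e => f ((Fin.cons c a : Fin (k + 1) → C) e)) =
      f c ::ₘ (univ : Finset (Fin k)).val.map (fun e => f (a e)) := by
  rw [Fin.univ_succ, Finset.cons_val, Multiset.map_cons, Finset.map_val, Multiset.map_map]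
  rfl

variable {n : ℕ} {x : Fin n → ℂ} {u v : (Fin n → ℂ) → ℂ}

theorem frozenLaplacian_congr (Φ : (Fin n → ℂ) → ℝ) (h : u =ᶠ[𝓝 x] v) :
    frozenLaplacian Φ x u =ᶠ[𝓝 x] frozenLaplacian Φ x v := by
  have : ∀ᶠ y in 𝓝 x, ∀ i j : Fin n,
      wirtList [Sum.inl i, Sum.inr j] u y = wirtList [Sum.inl i, Sum.inr j] v y :=
    eventually_all.2 fun i => eventually_all.2 fun j => wirtList_congr h _
  filter_upwards [this] with y hy
  simp only [frozenLaplacian, hy]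

theorem wirtList_linear_combination {κ : Type*} [Fintype κ] (c : κ → ℂ)
    (F : κ → (Fin n → ℂ) → ℂ) (hF : ∀ i, ContDiffAt ℝ ∞ (F i) x) (l : List (Idx n)) :
    wirtList l (fun y => ∑ i, c i * F i y) =ᶠ[𝓝 x] fun y => ∑ i, c i * wirtList l (F i) y := by
  refine (wirtList_sum univ (fun i y => c i * F i y)
    (fun i _ => contDiffAt_const.mul (hF i)) l).trans ?_
  have : ∀ᶠ y in 𝓝 x, ∀ i, wirtList l (fun y => c i * F i y) y = c i * wirtList l (F i) y :=
    eventually_all.2 fun i => wirtList_const_mul (c i) (hF i) l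
  filter_upwards [this] with y hy
  exact Finset.sum_congr rfl fun i _ => hy i

/-- Since the coefficients are frozen, `L^k` is the contraction of the derivatives of order `2k`
with `k` copies of the inverse metric. -/
theorem frozenLaplacian_iterate (Φ : (Fin n → ℂ) → ℝ) (hu : ContDiffAt ℝ ∞ u x) (k : ℕ) :
    (frozenLaplacian Φ x)^[k] u =ᶠ[𝓝 x] fun y => ∑ a : Fin k → Fin n, ∑ b : Fin k → Fin n,
      (∏ e, invMetric Φ x (a e) (b e)) *
        wirtMultiset ((univ : Finset (Fin k ⊕ Fin k)).val.map (Sum.map a b)) u y := by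
  induction k with
  | zero => simp
  | succ k ih =>
    rw [Function.iterate_succ_apply']
    refine (frozenLaplacian_congr Φ ih).trans ?_
    have h1 : ∀ᶠ y in 𝓝 x, ∀ i j : Fin n, _ := eventually_all.2 fun i => eventually_all.2 fun j =>
      wirtList_linear_combination
        (fun p : (Fin k → Fin n) × (Fin k → Fin n) => ∏ e, invMetric Φ x (p.1 e) (p.2 e))
        (fun p => wirtMultiset ((univ : Finset (Fin k ⊕ Fin k)).val.map (Sum.map p.1 p.2)) u)
        (fun p => contDiffAt_wirtMultiset hu _) [Sum.inl i, Sum.inr j]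
    have h2 : ∀ᶠ y in 𝓝 x, ∀ (i j : Fin n) (a b : Fin k → Fin n),
        wirtMultiset (Sum.inl i ::ₘ Sum.inr j ::ₘ
          ((univ : Finset (Fin k ⊕ Fin k)).val.map (Sum.map a b))) u y =
        wirtList [Sum.inl i, Sum.inr j]
          (wirtMultiset ((univ : Finset (Fin k ⊕ Fin k)).val.map (Sum.map a b)) u) y :=
      eventually_all.2 fun i => eventually_all.2 fun j => eventually_all.2 fun a =>
        eventually_all.2 fun b => (wirtMultiset_cons hu _ _).trans
          (wirt_congr (wirtMultiset_cons hu _ _) _)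
    filter_upwards [h1, h2] with y hy1 hy2
    have h3 : ∀ (i j : Fin n) (a b : Fin k → Fin n),
        ((univ : Finset (Fin (k + 1) ⊕ Fin (k + 1))).val.map
          (Sum.map (Fin.cons i a : Fin (k + 1) → Fin n) (Fin.cons j b : Fin (k + 1) → Fin n))) =
        (Sum.inl i ::ₘ Sum.inr j ::ₘ
          ((univ : Finset (Fin k ⊕ Fin k)).val.map (Sum.map a b)) : Multiset (Idx n)) := by
      intro i j a b
      rw [map_univ_sumMap, map_univ_sumMap, map_univ_cons Sum.inl, map_univ_cons Sum.inr]
      simp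
    have h4 : ∀ i j, wirtList [Sum.inl i, Sum.inr j] (fun y => ∑ a : Fin k → Fin n,
        ∑ b : Fin k → Fin n, (∏ e, invMetric Φ x (a e) (b e)) *
        wirtMultiset ((univ : Finset (Fin k ⊕ Fin k)).val.map (Sum.map a b)) u y) y =
        ∑ a : Fin k → Fin n, ∑ b : Fin k → Fin n, (∏ e, invMetric Φ x (a e) (b e)) *
          wirtMultiset (Sum.inl i ::ₘ Sum.inr j ::ₘ
          ((univ : Finset (Fin k ⊕ Fin k)).val.map (Sum.map a b))) u y := by
      intro i j
      have := hy1 i j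
      simp only [Fintype.sum_prod_type] at this
      rw [this]
      simp only [hy2]
    simp only [frozenLaplacian, h4]
    rw [sum_fin_succ_arrow]
    refine Finset.sum_congr rfl fun i _ => ?_
    simp only [sum_fin_succ_arrow (C := Fin n)]
    conv_rhs => rw [Finset.sum_comm]
    refine Finset.sum_congr rfl fun j _ => ?_
    rw [Finset.mul_sum]
    refine Finset.sum_congr rfl fun a _ => ?_
    rw [Finset.mul_sum]
    refine Finset.sum_congr rfl fun b _ => ?_
    rw [h3, Fin.prod_univ_succ]
    simp only [Fin.cons_zero, Fin.cons_succ]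
    ring

end Laplacian

/-! ### Determinants as sums over principal minors -/

section Det

theorem sum_det_submatrix {ι R : Type*} [Fintype ι] [DecidableEq ι] [CommRing R]
    (N : Matrix ι ι R) (m : ℕ) :
    ∑ i : Fin m → ι, (N.submatrix i i).det = (m.factorial : R) *
      ∑ s ∈ (univ : Finset ι).powersetCard m, (N.submatrix (Subtype.val : s → ι) Subtype.val).det := by
  have h0 : ∑ i : Fin m → ι, (N.submatrix i i).det =
      ∑ i ∈ univ.filter (fun i : Fin m → ι => Function.Injective i), (N.submatrix i i).det := by
    refine (Finset.sum_filter_of_ne fun i _ hne => ?_).symm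
    intro p q hpq
    by_contra hne'
    exact hne (Matrix.det_zero_of_row_eq hne' (by funext r; simp [hpq]))
  rw [h0, ← Finset.sum_fiberwise_of_maps_to (t := (univ : Finset ι).powersetCard m)
    (g := fun i => univ.image i), Finset.mul_sum]
  · refine Finset.sum_congr rfl fun s hs => ?_
    have hcard : s.card = m := (Finset.mem_powersetCard.1 hs).2
    let e0 : Fin m ≃ s := (Fintype.equivFinOfCardEq (by simpa using hcard)).symm
    have h1 : ∀ i : Fin m → ι, i ∈ (univ.filter (fun i : Fin m → ι => Function.Injective i)).filter
        (fun i => univ.image i = s) ↔ ∃ e : Fin m ≃ s, (fun r => (e r : ι)) = i := by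
      intro i
      simp only [Finset.mem_filter, Finset.mem_univ, true_and]
      constructor
      · rintro ⟨hi, rfl⟩
        refine ⟨Equiv.ofBijective (fun r => ⟨i r, by simp⟩) ⟨fun p q h => hi (by simpa using h),
          ?_⟩, rfl⟩
        rintro ⟨y, hy⟩
        obtain ⟨r, -, rfl⟩ := Finset.mem_image.1 hy
        exact ⟨r, rfl⟩
      · rintro ⟨e, rfl⟩
        refine ⟨Subtype.val_injective.comp e.injective, ?_⟩
        ext y
        simp only [Finset.mem_image, Finset.mem_univ, true_and]
        constructor
        · rintro ⟨r, rfl⟩; exact (e r).2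
        · intro hy; exact ⟨e.symm ⟨y, hy⟩, by simp⟩
    have h2 : (univ.filter (fun i : Fin m → ι => Function.Injective i)).filter
        (fun i => univ.image i = s) =
        (univ : Finset (Fin m ≃ s)).image (fun e r => (e r : ι)) := by
      ext i
      rw [h1]; simp
    rw [h2, Finset.sum_image fun e _ e' _ h => Equiv.ext fun r => Subtype.ext (congrFun h r)]
    have h3 : ∀ e : Fin m ≃ s, (N.submatrix (fun r => (e r : ι)) (fun r => (e r : ι))).det =
        (N.submatrix (Subtype.val : s → ι) Subtype.val).det := fun e =>
      Matrix.det_submatrix_equiv_self e (N.submatrix (Subtype.val : s → ι) Subtype.val)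
    simp only [h3, Finset.sum_const, nsmul_eq_mul]
    rw [Finset.card_univ, Fintype.card_equiv e0, Fintype.card_fin]
  · intro i hi
    rw [Finset.mem_powersetCard]
    refine ⟨Finset.subset_univ _, ?_⟩
    rw [Finset.card_image_of_injective _ (Finset.mem_filter.1 hi).2]
    simp

/-- `det (1 + N)` as a sum over labelled principal minors. Tuples `i` with a repeated entry
contribute `0`, so any bound `M` beyond the size of the matrix may be used. -/
theorem det_one_add_eq_sum {ι K : Type*} [Fintype ι] [DecidableEq ι] [Field K] [CharZero K]
    (N : Matrix ι ι K) (M : ℕ) (hM : Fintype.card ι < M) :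
    (1 + N).det = ∑ m ∈ range M, ((m.factorial : K))⁻¹ *
      ∑ i : Fin m → ι, (N.submatrix i i).det := by
  have h1 : (1 + N).det = ((1 + (Polynomial.X : Polynomial K) •
      N.map Polynomial.C).det).eval 1 := by
    rw [← Polynomial.coe_evalRingHom, RingHom.map_det]
    congr 1
    ext p q
    by_cases h : p = q <;> simp [h]
  have h2 : ((1 + (Polynomial.X : Polynomial K) • N.map Polynomial.C).det).natDegree < M := by
    refine lt_of_le_of_lt ?_ hM
    have := Polynomial.natDegree_det_X_add_C_le N 1
    rwa [Matrix.map_one _ (map_zero _) (map_one _), add_comm] at this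
  rw [h1, Polynomial.eval_eq_sum_range' h2]
  refine Finset.sum_congr rfl fun m _ => ?_
  rw [Matrix.coeff_det_one_add_X_smul_eq_sum_minors, sum_det_submatrix, one_pow, mul_one,
    inv_mul_cancel_left₀ (by exact_mod_cast m.factorial_ne_zero)]

end Det

/-! ### Weyl invariants of labelled digraphs as functions of jets -/

section Jets

variable {n : ℕ}

/-- The indices of the half-edges at `w`, for a digraph with arbitrary edge and vertex types whose
edge `e` carries `a e` at its source and `b e` at its target. -/
def halves {E W : Type*} [Fintype E] [DecidableEq W] (src tgt : E → W) (a b : E → Fin n) (w : W) :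
    Multiset (Idx n) :=
  ((univ.filter fun e => src e = w).val.map fun e => Sum.inl (a e)) +
    ((univ.filter fun e => tgt e = w).val.map fun e => Sum.inr (b e))

/-- The Weyl invariant of a digraph with vertex set `Option V`, in terms of the contraction `h`, the
jet `φ` attached to the ordinary vertices and the jet `ψ` attached to the distinguished vertex. A
jet is the family of derivatives at a point, indexed by multisets of indices. -/
noncomputable def jetWeyl {E V : Type*} [Fintype E] [DecidableEq E] [Fintype V] [DecidableEq V]
    (h : Fin n → Fin n → ℂ) (φ ψ : Multiset (Idx n) → ℂ) (src tgt : E → Option V) : ℂ :=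
  ∑ a : E → Fin n, ∑ b : E → Fin n, (∏ e, h (a e) (b e)) *
    (∏ v : V, φ (halves src tgt a b (some v))) * ψ (halves src tgt a b none)

/-- A multiset of indices is stable if it has a barred index, an unbarred index, and at least three
elements. -/
def IsStable (s : Multiset (Idx n)) : Prop :=
  1 ≤ s.countP (fun α => α.isLeft) ∧ 1 ≤ s.countP (fun α => α.isRight) ∧ 3 ≤ s.card

open Classical in
/-- The jet of the potential `Φ` at `x`, cut down to stable multisets of indices. -/
noncomputable def stableJet (Φ : (Fin n → ℂ) → ℝ) (x : Fin n → ℂ) (s : Multiset (Idx n)) : ℂ :=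
  if IsStable s then wirtMultiset s (fun w => (Φ w : ℂ)) x else 0

theorem isStable_add_pair (s : Multiset (Idx n)) (p q : Fin n) :
    IsStable (s + {Sum.inl p, Sum.inr q}) ↔ s ≠ 0 := by
  simp only [IsStable, Multiset.insert_eq_cons, Multiset.countP_add, Multiset.card_add,
    Multiset.countP_cons, Multiset.card_cons, ← Multiset.cons_zero,
    Multiset.countP_zero, Multiset.card_zero]
  rw [← Multiset.card_pos]
  simp
  omega

theorem exists_eq_map_inl (l : List (Idx n)) (h : l.countP (fun α => α.isRight) = 0) :
    ∃ l' : List (Fin n), l = l'.map Sum.inl := by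
  induction l with
  | nil => exact ⟨[], rfl⟩
  | cons α l ih =>
    rcases α with i | i
    · obtain ⟨l', rfl⟩ := ih (by simpa using h)
      exact ⟨i :: l', rfl⟩
    · simp at h

theorem exists_eq_map_inr (l : List (Idx n)) (h : l.countP (fun α => α.isLeft) = 0) :
    ∃ l' : List (Fin n), l = l'.map Sum.inr := by
  induction l with
  | nil => exact ⟨[], rfl⟩
  | cons α l ih =>
    rcases α with i | i
    · simp at h
    · obtain ⟨l', rfl⟩ := ih (by simpa using h)
      exact ⟨i :: l', rfl⟩

theorem IsStable.exists_eq_add_pair {s : Multiset (Idx n)} (hs : IsStable s) :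
    ∃ (t : Multiset (Idx n)) (p q : Fin n), t ≠ 0 ∧ s = t + {Sum.inl p, Sum.inr q} := by
  obtain ⟨h1, h2, -⟩ := id hs
  obtain ⟨α, hα, hα'⟩ := Multiset.countP_pos.1 h1
  obtain ⟨β, hβ, hβ'⟩ := Multiset.countP_pos.1 h2
  obtain ⟨p, rfl⟩ := Sum.isLeft_iff.1 hα'
  obtain ⟨q, rfl⟩ := Sum.isRight_iff.1 hβ'
  obtain ⟨t, rfl⟩ := Multiset.exists_cons_of_mem hα
  obtain ⟨t, rfl⟩ := Multiset.exists_cons_of_mem (by simpa using hβ : Sum.inr q ∈ t)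
  have e : Sum.inl p ::ₘ Sum.inr q ::ₘ t = t + {Sum.inl p, Sum.inr q} := by
    simp [Multiset.insert_eq_cons, ← Multiset.cons_zero]
  rw [e] at hs ⊢
  exact ⟨t, p, q, (isStable_add_pair t p q).1 hs, rfl⟩

variable {x : Fin n → ℂ} {Φ : (Fin n → ℂ) → ℝ}

theorem wirtMultiset_coe_apply {u : (Fin n → ℂ) → ℂ} (hu : ContDiffAt ℝ ∞ u x)
    {s : Multiset (Idx n)} {l : List (Idx n)} (h : s = l) : wirtMultiset s u x = wirtList l u x := by
  subst h
  exact (wirtMultiset_coe hu l).self_of_nhds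

/-- The jet of the phase remainder is minus the stable jet of the potential. -/
theorem wirtMultiset_phaseRemainder {S : (Fin n → ℂ) → ℂ} (hS : IsPhaseRemainder Φ x S)
    (hΦ : ContDiffAt ℝ ∞ (fun w => (Φ w : ℂ)) x) (s : Multiset (Idx n)) :
    wirtMultiset s S x = - stableJet Φ x s := by
  by_cases hs : IsStable s
  · rw [stableJet, if_pos hs]
    obtain ⟨t, p, q, ht, rfl⟩ := hs.exists_eq_add_pair
    have e : t + {Sum.inl p, Sum.inr q} = ((t.toList ++ [Sum.inl p, Sum.inr q] : List (Idx n)) :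
        Multiset (Idx n)) := by
      rw [← Multiset.coe_add, Multiset.coe_toList]; rfl
    rw [wirtMultiset_coe_apply hS.smooth e, wirtMultiset_coe_apply hΦ e,
      hS.mixed _ _ _ (by simpa using ht), wirtList_append]
    rfl
  · rw [stableJet, if_neg hs, neg_zero]
    simp only [IsStable, not_and_or] at hs
    rcases hs with hs | hs | hs
    · obtain ⟨l, hl⟩ := exists_eq_map_inr s.toList (by
        rw [← Multiset.coe_toList s, Multiset.coe_countP] at hs
        simp only [Bool.decide_eq_true] at hs
        omega)
      rw [wirtMultiset, hl]
      exact hS.antiholomorphic l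
    · obtain ⟨l, hl⟩ := exists_eq_map_inl s.toList (by
        rw [← Multiset.coe_toList s, Multiset.coe_countP] at hs
        simp only [Bool.decide_eq_true] at hs
        omega)
      rw [wirtMultiset, hl]
      exact hS.holomorphic l
    · exact hS.low _ (by simp; omega)

theorem contDiffAt_metric (hΦ : ContDiffAt ℝ ∞ (fun w => (Φ w : ℂ)) x) (p q : Fin n) :
    ContDiffAt ℝ ∞ (fun y => metric Φ y p q) x :=
  contDiffAt_wirtList hΦ [Sum.inl p, Sum.inr q]

theorem wirtMultiset_metric_sub (hΦ : ContDiffAt ℝ ∞ (fun w => (Φ w : ℂ)) x) (p q : Fin n)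
    (s : Multiset (Idx n)) :
    wirtMultiset s (fun y => metric Φ y p q - metric Φ x p q) x =
      stableJet Φ x (s + {Sum.inl p, Sum.inr q}) := by
  rw [stableJet]
  by_cases hs : s = 0
  · subst hs
    rw [if_neg (by rw [isStable_add_pair]; simp)]
    simp
  · rw [if_pos ((isStable_add_pair _ _ _).2 hs)]
    have e : s + {Sum.inl p, Sum.inr q} = ((s.toList ++ [Sum.inl p, Sum.inr q] : List (Idx n)) :
        Multiset (Idx n)) := by
      rw [← Multiset.coe_add, Multiset.coe_toList]; rfl
    rw [wirtMultiset_coe_apply hΦ e, wirtList_append]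
    have h1 := (wirtList_sum (x := x) univ
      (fun (b : Bool) (y : Fin n → ℂ) => if b then metric Φ y p q else -metric Φ x p q)
      (fun b _ => by
        cases b
        · simpa using contDiffAt_const
        · simpa using contDiffAt_metric hΦ p q) s.toList).self_of_nhds
    simp only [Fintype.sum_bool, if_true, Bool.false_eq_true, if_false] at h1
    have h2 := congrFun (wirtList_const (-metric Φ x p q) s.toList (by simpa using hs)) x
    rw [h2, add_zero] at h1
    simp only [sub_eq_add_neg]
    exact h1

theorem map_filter_elim {A W : Type*} [Fintype A] [DecidableEq W] (src tgt : A → W)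
    (a b : A → Fin n) (w : W) :
    (univ.filter fun e : A ⊕ A => Sum.elim src tgt e = w).val.map (Sum.map a b) =
      halves src tgt a b w := by
  have : (univ.filter fun e : A ⊕ A => Sum.elim src tgt e = w) =
      (univ.filter fun e => src e = w).disjSum (univ.filter fun e => tgt e = w) := by
    ext (e | e) <;> simp
  rw [this, Finset.val_disjSum, Multiset.disjSum, Multiset.map_add, Multiset.map_map,
    Multiset.map_map]
  rfl

/-- Wick expansion: the Laplacian `L^k` of a product indexed by the vertices is the sum over all
digraphs with `k` edges on these vertices. -/
theorem frozenLaplacian_iterate_prod (Φ : (Fin n → ℂ) → ℝ) (x : Fin n → ℂ) {W : Type*} [Fintype W]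
    [DecidableEq W] (F : W → (Fin n → ℂ) → ℂ) (hF : ∀ w, ContDiffAt ℝ ∞ (F w) x) (k : ℕ) :
    (frozenLaplacian Φ x)^[k] (fun y => ∏ w, F w y) x =
      ∑ src : Fin k → W, ∑ tgt : Fin k → W, ∑ a : Fin k → Fin n, ∑ b : Fin k → Fin n,
        (∏ e, invMetric Φ x (a e) (b e)) * ∏ w, wirtMultiset (halves src tgt a b w) (F w) x := by
  rw [(frozenLaplacian_iterate Φ (contDiffAt_prod fun w _ => hF w) k).self_of_nhds]
  have h : ∀ a b : Fin k → Fin n,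
      wirtMultiset ((univ : Finset (Fin k ⊕ Fin k)).val.map (Sum.map a b))
        (fun y => ∏ w, F w y) x = ∑ src : Fin k → W, ∑ tgt : Fin k → W,
          ∏ w, wirtMultiset (halves src tgt a b w) (F w) x := by
    intro a b
    rw [(wirtMultiset_prod F hF (Sum.map a b)).self_of_nhds]
    beta_reduce
    rw [sum_arrow_sum]
    simp only [map_filter_elim]
  simp only [h, Finset.mul_sum]
  rw [← Finset.sum_comm_cycle]
  simp only [Finset.sum_comm (s := (univ : Finset (Fin k → W)))
    (t := (univ : Finset (Fin k → Fin n)))]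
  rw [Finset.sum_comm]

/-- Extend an edge map by one edge for each vertex of the right summand, with endpoint the image of
that vertex under `σ`. -/
def extendEdges {A V₁ V₂ : Type*} (src : A → Option (V₁ ⊕ V₂)) (σ : Equiv.Perm V₂) :
    A ⊕ V₂ → Option (V₁ ⊕ V₂) :=
  Sum.elim src fun v => some (Sum.inr (σ v))

section Extend

variable {A V₁ V₂ : Type*} [Fintype A] [Fintype V₂] [DecidableEq V₁] [DecidableEq V₂]

theorem filter_extendEdges (src : A → Option (V₁ ⊕ V₂)) (σ : Equiv.Perm V₂)
    (w : Option (V₁ ⊕ V₂)) :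
    (univ.filter fun e => extendEdges src σ e = w) = (univ.filter fun e => src e = w).disjSum
      (univ.filter fun v => some (Sum.inr (σ v)) = w) := by
  ext (e | e) <;> rw [Finset.mem_filter] <;> simp [extendEdges]

theorem halves_extendEdges (src tgt : A → Option (V₁ ⊕ V₂)) (σ τ : Equiv.Perm V₂)
    (a b : A → Fin n) (p i : V₂ → Fin n) (w : Option (V₁ ⊕ V₂)) :
    halves (extendEdges src σ) (extendEdges tgt τ) (Sum.elim a p) (Sum.elim b i) w =
      halves src tgt a b w +
        ((univ.filter fun v => some (Sum.inr (σ v)) = w).val.map (fun v => Sum.inl (p v)) +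
        (univ.filter fun v => some (Sum.inr (τ v)) = w).val.map (fun v => Sum.inr (i v))) := by
  simp only [halves, filter_extendEdges, Finset.val_disjSum, Multiset.disjSum, Multiset.map_add,
    Multiset.map_map, Function.comp_def, Sum.elim_inl, Sum.elim_inr]
  abel

theorem halves_extendEdges_none (src tgt : A → Option (V₁ ⊕ V₂)) (σ τ : Equiv.Perm V₂)
    (a b : A → Fin n) (p i : V₂ → Fin n) :
    halves (extendEdges src σ) (extendEdges tgt τ) (Sum.elim a p) (Sum.elim b i) none =
      halves src tgt a b none := by
  rw [halves_extendEdges]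
  simp

theorem halves_extendEdges_inl (src tgt : A → Option (V₁ ⊕ V₂)) (σ τ : Equiv.Perm V₂)
    (a b : A → Fin n) (p i : V₂ → Fin n) (v : V₁) :
    halves (extendEdges src σ) (extendEdges tgt τ) (Sum.elim a p) (Sum.elim b i)
      (some (Sum.inl v)) = halves src tgt a b (some (Sum.inl v)) := by
  rw [halves_extendEdges]
  simp

theorem halves_extendEdges_inr (src tgt : A → Option (V₁ ⊕ V₂)) (σ τ : Equiv.Perm V₂)
    (a b : A → Fin n) (p i : V₂ → Fin n) (v : V₂) :
    halves (extendEdges src σ) (extendEdges tgt τ) (Sum.elim a p) (Sum.elim b i)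
      (some (Sum.inr v)) = halves src tgt a b (some (Sum.inr v)) +
        {Sum.inl (p (σ.symm v)), Sum.inr (i (τ.symm v))} := by
  have h : ∀ σ : Equiv.Perm V₂, (univ.filter fun u => some (Sum.inr (σ u)) =
      (some (Sum.inr v) : Option (V₁ ⊕ V₂))) = {σ.symm v} := by
    intro σ
    ext u
    simp [Equiv.eq_symm_apply]
  rw [halves_extendEdges, h, h]
  rfl

end Extend

theorem jetWeyl_extendEdges {A V₁ V₂ : Type*} [Fintype A] [Fintype V₁] [Fintype V₂] [DecidableEq A]
    [DecidableEq V₁] [DecidableEq V₂] (h : Fin n → Fin n → ℂ) (φ ψ : Multiset (Idx n) → ℂ)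
    (src tgt : A → Option (V₁ ⊕ V₂)) (σ : Equiv.Perm V₂) :
    jetWeyl h φ ψ (extendEdges src 1) (extendEdges tgt σ.symm) =
      ∑ p : V₂ → Fin n, ∑ i : V₂ → Fin n, (∏ v, h (p v) (i v)) *
        ∑ a : A → Fin n, ∑ b : A → Fin n, (∏ e, h (a e) (b e)) *
          ((∏ v, φ (halves src tgt a b (some (Sum.inl v)))) *
            (∏ v, φ (halves src tgt a b (some (Sum.inr v)) + {Sum.inl (p v), Sum.inr (i (σ v))})) *
            ψ (halves src tgt a b none)) := by
  rw [jetWeyl, sum_arrow_sum, Finset.sum_comm]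
  refine Finset.sum_congr rfl fun p _ => ?_
  simp only [sum_arrow_sum, Finset.mul_sum]
  conv_rhs =>
    rw [Finset.sum_comm]
  refine Finset.sum_congr rfl fun a _ => ?_
  rw [Finset.sum_comm]
  refine Finset.sum_congr rfl fun i _ => ?_
  refine Finset.sum_congr rfl fun b _ => ?_
  simp only [Fintype.prod_sum_type, Sum.elim_inl, Sum.elim_inr, halves_extendEdges_none,
    halves_extendEdges_inl, halves_extendEdges_inr, Equiv.symm_symm]
  simp only [inv_one, ← Equiv.Perm.inv_def, Equiv.Perm.one_apply]
  ring

end Jets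

/-! ### The graph expansion of the operators `R_j` -/

section Expansion

variable {n : ℕ} {x : Fin n → ℂ} {Φ : (Fin n → ℂ) → ℝ}

theorem frozenLaplacian_iterate_linear_combination {κ : Type*} [Fintype κ] (c : κ → ℂ)
    (F : κ → (Fin n → ℂ) → ℂ) (hF : ∀ i, ContDiffAt ℝ ∞ (F i) x) (k : ℕ) :
    (frozenLaplacian Φ x)^[k] (fun y => ∑ i, c i * F i y) x =
      ∑ i, c i * (frozenLaplacian Φ x)^[k] (F i) x := by
  have hs : ContDiffAt ℝ ∞ (fun y => ∑ i, c i * F i y) x :=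
    ContDiffAt.sum fun i _ => contDiffAt_const.mul (hF i)
  rw [(frozenLaplacian_iterate Φ hs k).self_of_nhds]
  have h1 : ∀ i, (frozenLaplacian Φ x)^[k] (F i) x = _ := fun i =>
    (frozenLaplacian_iterate Φ (hF i) k).self_of_nhds
  have h2 : ∀ s : Multiset (Idx n), wirtMultiset s (fun y => ∑ i, c i * F i y) x =
      ∑ i, c i * wirtMultiset s (F i) x := fun s =>
    (wirtList_linear_combination c F hF s.toList).self_of_nhds
  simp only [h1, h2, Finset.mul_sum]
  rw [Finset.sum_comm_cycle]
  refine Finset.sum_congr rfl fun i _ => ?_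
  refine Finset.sum_congr rfl fun a _ => Finset.sum_congr rfl fun b _ => ?_
  ring

/-- The determinant of the metric at `y`, expanded around `x` along permutations of labelled sets of
matrix indices. -/
theorem det_metric_eq_sum (hG : IsUnit (metric Φ x).det) (M : ℕ) (hM : n < M) (y : Fin n → ℂ) :
    (metric Φ y).det = (metric Φ x).det * ∑ m ∈ range M, ((m.factorial : ℂ))⁻¹ *
      ∑ i : Fin m → Fin n, ∑ σ : Equiv.Perm (Fin m), ((Equiv.Perm.sign σ : ℤ) : ℂ) *
        ∑ p : Fin m → Fin n, (∏ v, invMetric Φ x (p v) (i v)) *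
          ∏ v, (metric Φ y (p v) (i (σ v)) - metric Φ x (p v) (i (σ v))) := by
  set N : Matrix (Fin n) (Fin n) ℂ := (metric Φ x)⁻¹ * (metric Φ y - metric Φ x) with hN
  have h1 : metric Φ y = metric Φ x * (1 + N) := by
    rw [hN, Matrix.mul_add, ← Matrix.mul_assoc, Matrix.mul_nonsing_inv _ hG, Matrix.one_mul,
      Matrix.mul_one]
    abel
  have h2 := congrArg Matrix.det h1
  rw [Matrix.det_mul, det_one_add_eq_sum N M (by simpa using hM)] at h2
  rw [h2]
  congr 1
  refine Finset.sum_congr rfl fun m _ => ?_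
  congr 1
  refine Finset.sum_congr rfl fun i _ => ?_
  rw [← Matrix.det_transpose, Matrix.det_apply']
  refine Finset.sum_congr rfl fun σ _ => ?_
  congr 1
  simp only [Matrix.transpose_apply, Matrix.submatrix_apply, hN, Matrix.mul_apply,
    Matrix.sub_apply]
  rw [Finset.prod_univ_sum, Fintype.piFinset_univ]
  refine Finset.sum_congr rfl fun p _ => ?_
  rw [← Finset.prod_mul_distrib]
  rfl

/-- The contribution to `R_j` of `l` factors `S` and of `m` vertices that come from the determinant
of the metric and are permuted cyclically by `σ`. -/
theorem sum_frozenLaplacian_iterate_eq {f S : (Fin n → ℂ) → ℂ}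
    (hΦ : ContDiffAt ℝ ∞ (fun w => (Φ w : ℂ)) x) (hf : ContDiffAt ℝ ∞ f x)
    (hS : IsPhaseRemainder Φ x S) (k l m : ℕ) (σ : Equiv.Perm (Fin m)) :
    ∑ p : Fin m → Fin n, ∑ i : Fin m → Fin n, (∏ v, invMetric Φ x (p v) (i v)) *
      (frozenLaplacian Φ x)^[k] (fun y => f y *
        (∏ v, (metric Φ y (p v) (i (σ v)) - metric Φ x (p v) (i (σ v)))) * S y ^ l) x =
    (-1) ^ l * ∑ src : Fin k → Option (Fin l ⊕ Fin m), ∑ tgt : Fin k → Option (Fin l ⊕ Fin m),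
      jetWeyl (invMetric Φ x) (stableJet Φ x) (fun s => wirtMultiset s f x)
        (extendEdges src 1) (extendEdges tgt σ.symm) := by
  have key : ∀ p i : Fin m → Fin n, (frozenLaplacian Φ x)^[k] (fun y => f y *
        (∏ v, (metric Φ y (p v) (i (σ v)) - metric Φ x (p v) (i (σ v)))) * S y ^ l) x =
      (-1) ^ l * ∑ src : Fin k → Option (Fin l ⊕ Fin m), ∑ tgt : Fin k → Option (Fin l ⊕ Fin m),
        ∑ a : Fin k → Fin n, ∑ b : Fin k → Fin n, (∏ e, invMetric Φ x (a e) (b e)) *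
          ((∏ v, stableJet Φ x (halves src tgt a b (some (Sum.inl v)))) *
            (∏ v, stableJet Φ x
              (halves src tgt a b (some (Sum.inr v)) + {Sum.inl (p v), Sum.inr (i (σ v))})) *
            wirtMultiset (halves src tgt a b none) f x) := by
    intro p i
    let F : Option (Fin l ⊕ Fin m) → (Fin n → ℂ) → ℂ := fun o => o.elim f
      (Sum.elim (fun _ => S) fun v y =>
        metric Φ y (p v) (i (σ v)) - metric Φ x (p v) (i (σ v)))
    have hF : ∀ o, ContDiffAt ℝ ∞ (F o) x := by
      rintro (_ | v | v)
      · exact hf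
      · exact hS.smooth
      · exact (contDiffAt_metric hΦ _ _).sub contDiffAt_const
    have hprod : (fun y => f y *
        (∏ v, (metric Φ y (p v) (i (σ v)) - metric Φ x (p v) (i (σ v)))) * S y ^ l) =
        fun y => ∏ o, F o y := by
      funext y
      simp [F, Fintype.prod_option, Fintype.prod_sum_type]
      ring
    rw [hprod, frozenLaplacian_iterate_prod Φ x F hF]
    simp only [Fintype.prod_option, Fintype.prod_sum_type, Finset.mul_sum]
    refine Finset.sum_congr rfl fun src _ => Finset.sum_congr rfl fun tgt _ =>
      Finset.sum_congr rfl fun a _ => Finset.sum_congr rfl fun b _ => ?_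
    have h1 : ∀ v : Fin l, wirtMultiset (halves src tgt a b (some (Sum.inl v)))
        (F (some (Sum.inl v))) x = (-1) * stableJet Φ x (halves src tgt a b (some (Sum.inl v))) :=
      fun v => by
        rw [neg_one_mul]
        exact wirtMultiset_phaseRemainder hS hΦ _
    have h2 : ∀ v : Fin m, wirtMultiset (halves src tgt a b (some (Sum.inr v)))
        (F (some (Sum.inr v))) x = stableJet Φ x
          (halves src tgt a b (some (Sum.inr v)) + {Sum.inl (p v), Sum.inr (i (σ v))}) :=
      fun v => wirtMultiset_metric_sub hΦ _ _ _
    simp only [h1, h2, Finset.prod_mul_distrib, Finset.prod_const, Finset.card_univ,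
      Fintype.card_fin]
    simp only [F, Option.elim_none]
    ring
  simp only [key, jetWeyl_extendEdges]
  simp only [Finset.mul_sum]
  have comm : ∀ G : (Fin m → Fin n) → (Fin m → Fin n) → (Fin k → Option (Fin l ⊕ Fin m)) →
      (Fin k → Option (Fin l ⊕ Fin m)) → ℂ,
      ∑ p, ∑ i, ∑ src, ∑ tgt, G p i src tgt = ∑ src, ∑ tgt, ∑ p, ∑ i, G p i src tgt := by
    intro G
    rw [Finset.sum_comm_cycle]
    refine Finset.sum_congr rfl fun src _ => ?_
    rw [Finset.sum_comm_cycle]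
  rw [comm]
  refine Finset.sum_congr rfl fun src _ => Finset.sum_congr rfl fun tgt _ =>
    Finset.sum_congr rfl fun p _ => Finset.sum_congr rfl fun i _ =>
    Finset.sum_congr rfl fun a _ => Finset.sum_congr rfl fun b _ => ?_
  ring

/-- The expansion of `R_j` as a sum over digraphs with labelled vertices and edges, together with a
permutation of the vertices that come from the determinant of the metric. -/
theorem englisR_eq_sum {f S : (Fin n → ℂ) → ℂ}
    (hΦ : ContDiffAt ℝ ∞ (fun w => (Φ w : ℂ)) x) (hf : ContDiffAt ℝ ∞ f x)
    (hS : IsPhaseRemainder Φ x S) (hG : IsUnit (metric Φ x).det) (j M : ℕ) (hM : n < M) :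
    englisR Φ S j f x = ∑ l ∈ range (2 * j + 1), ∑ m ∈ range M,
      (((j + l).factorial : ℂ) * l.factorial * m.factorial)⁻¹ *
      ((-1) ^ l * ∑ σ : Equiv.Perm (Fin m), ((Equiv.Perm.sign σ : ℤ) : ℂ) *
        ∑ src : Fin (j + l) → Option (Fin l ⊕ Fin m), ∑ tgt : Fin (j + l) → Option (Fin l ⊕ Fin m),
          jetWeyl (invMetric Φ x) (stableJet Φ x) (fun s => wirtMultiset s f x)
            (extendEdges src 1) (extendEdges tgt σ.symm)) := by
  have hk : ∀ G : ℕ → ℂ, ∑ k ∈ Icc j (3 * j), G k = ∑ l ∈ range (2 * j + 1), G (j + l) := by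
    intro G
    rw [← Finset.Ico_succ_right_eq_Icc, Finset.sum_Ico_eq_sum_range]
    congr 2
    simp only [Order.succ_eq_add_one]
    omega
  rw [englisR, hk, Finset.mul_sum]
  refine Finset.sum_congr rfl fun l _ => ?_
  rw [Nat.add_sub_cancel_left]
  let κ : Type := Σ m : Fin M, Equiv.Perm (Fin m) × (Fin m → Fin n) × (Fin m → Fin n)
  let c : κ → ℂ := fun q => (metric Φ x).det * (((q.1 : ℕ).factorial : ℂ))⁻¹ *
    ((Equiv.Perm.sign q.2.1 : ℤ) : ℂ) * ∏ v, invMetric Φ x (q.2.2.1 v) (q.2.2.2 v)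
  let F : κ → (Fin n → ℂ) → ℂ := fun q y => f y * (∏ v, (metric Φ y (q.2.2.1 v)
    (q.2.2.2 (q.2.1 v)) - metric Φ x (q.2.2.1 v) (q.2.2.2 (q.2.1 v)))) * S y ^ l
  have hF : ∀ q, ContDiffAt ℝ ∞ (F q) x := fun q =>
    (hf.mul (contDiffAt_prod fun v _ => (contDiffAt_metric hΦ _ _).sub contDiffAt_const)).mul
      (hS.smooth.pow l)
  have hsum : (fun y => f y * (metric Φ y).det * S y ^ l) = fun y => ∑ q, c q * F q y := by
    funext y
    rw [det_metric_eq_sum hG M hM y, Fintype.sum_sigma, ← Fin.sum_univ_eq_sum_range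
      (fun m => ((m.factorial : ℂ))⁻¹ *
      ∑ i : Fin m → Fin n, ∑ σ : Equiv.Perm (Fin m), ((Equiv.Perm.sign σ : ℤ) : ℂ) *
        ∑ p : Fin m → Fin n, (∏ v, invMetric Φ x (p v) (i v)) *
          ∏ v, (metric Φ y (p v) (i (σ v)) - metric Φ x (p v) (i (σ v)))) M]
    simp only [Fintype.sum_prod_type, Finset.mul_sum, Finset.sum_mul]
    refine Finset.sum_congr rfl fun m _ => ?_
    rw [Finset.sum_comm]
    refine Finset.sum_congr rfl fun σ _ => ?_
    rw [Finset.sum_comm]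
    refine Finset.sum_congr rfl fun p _ => Finset.sum_congr rfl fun i _ => ?_
    simp only [c, F]
    ring
  rw [hsum, frozenLaplacian_iterate_linear_combination c F hF, Fintype.sum_sigma,
    ← Fin.sum_univ_eq_sum_range (fun m =>
      (((j + l).factorial : ℂ) * l.factorial * m.factorial)⁻¹ *
      ((-1) ^ l * ∑ σ : Equiv.Perm (Fin m), ((Equiv.Perm.sign σ : ℤ) : ℂ) *
        ∑ src : Fin (j + l) → Option (Fin l ⊕ Fin m), ∑ tgt : Fin (j + l) → Option (Fin l ⊕ Fin m),
          jetWeyl (invMetric Φ x) (stableJet Φ x) (fun s => wirtMultiset s f x)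
            (extendEdges src 1) (extendEdges tgt σ.symm))) M]
  simp only [Fintype.sum_prod_type]
  rw [Finset.mul_sum, Finset.mul_sum]
  refine Finset.sum_congr rfl fun m _ => ?_
  rw [Finset.mul_sum, Finset.mul_sum, Finset.mul_sum, Finset.mul_sum]
  refine Finset.sum_congr rfl fun σ _ => ?_
  have h := sum_frozenLaplacian_iterate_eq hΦ hf hS (j + l) l m σ
  rw [mul_left_comm ((-1 : ℂ) ^ l), ← h]
  simp only [Finset.mul_sum]
  refine Finset.sum_congr rfl fun p _ => Finset.sum_congr rfl fun i _ => ?_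
  have hd : (metric Φ x).det ≠ 0 := hG.ne_zero
  simp only [c, F]
  have h3 : ((metric Φ x).det)⁻¹ * (metric Φ x).det = 1 := inv_mul_cancel₀ hd
  rw [mul_inv]
  linear_combination ((((j + l).factorial : ℂ) * (l.factorial : ℂ))⁻¹ *
    ((((m : ℕ).factorial : ℂ))⁻¹ * ((Equiv.Perm.sign σ : ℤ) : ℂ) *
      (∏ v, invMetric Φ x (p v) (i v)) * (frozenLaplacian Φ x)^[j + l] (fun y => f y *
        (∏ v, (metric Φ y (p v) (i (σ v)) - metric Φ x (p v) (i (σ v)))) * S y ^ l) x)) * h3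

end Expansion

/-! ### Sums over digraphs with labelled vertices and edges -/

section Labelled

variable {n : ℕ}

theorem halves_equiv {E E' W W' : Type*} [Fintype E] [Fintype E'] [DecidableEq W] [DecidableEq W']
    (γ : E ≃ E') (β : W ≃ W') (src tgt : E → W) (a b : E' → Fin n) (w : W) :
    halves (γ.arrowCongr β src) (γ.arrowCongr β tgt) a b (β w) =
      halves src tgt (a ∘ γ) (b ∘ γ) w := by
  have h : ∀ s : E → W, (univ.filter fun e => γ.arrowCongr β s e = β w) =
      (univ.filter fun e => s e = w).map γ.toEmbedding := by
    intro s
    ext e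
    obtain ⟨e, rfl⟩ := γ.surjective e
    simp [Equiv.arrowCongr]
  rw [halves, h, h]
  simp [halves, Finset.map_val, Multiset.map_map]

theorem jetWeyl_equiv {E E' V V' : Type*} [Fintype E] [Fintype E'] [Fintype V] [Fintype V']
    [DecidableEq E] [DecidableEq E'] [DecidableEq V] [DecidableEq V']
    (h : Fin n → Fin n → ℂ) (φ ψ : Multiset (Idx n) → ℂ) (γ : E ≃ E') (β : V ≃ V')
    (src tgt : E → Option V) :
    jetWeyl h φ ψ (γ.arrowCongr (Equiv.optionCongr β) src)
      (γ.arrowCongr (Equiv.optionCongr β) tgt) = jetWeyl h φ ψ src tgt := by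
  unfold jetWeyl
  refine Fintype.sum_equiv (γ.symm.arrowCongr (Equiv.refl _)) _ _ fun a => ?_
  refine Fintype.sum_equiv (γ.symm.arrowCongr (Equiv.refl _)) _ _ fun b => ?_
  have e : ∀ a : E' → Fin n, γ.symm.arrowCongr (Equiv.refl _) a = a ∘ γ := fun a => rfl
  rw [e, e]
  have h0 := halves_equiv γ (Equiv.optionCongr β) src tgt a b none
  have h1 : ∀ v, halves (γ.arrowCongr (Equiv.optionCongr β) src)
      (γ.arrowCongr (Equiv.optionCongr β) tgt) a b (some (β v)) =
      halves src tgt (a ∘ γ) (b ∘ γ) (some v) := fun v =>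
    halves_equiv γ (Equiv.optionCongr β) src tgt a b (some v)
  rw [Equiv.optionCongr_apply, Option.map_none] at h0
  rw [h0, ← β.prod_comp, ← γ.prod_comp]
  simp only [h1]
  rfl

theorem exists_sum_equiv_extending {l m v : ℕ} (hv : v = l + m) {δ : Fin m → Fin v}
    (hδ : Function.Injective δ) : ∃ β : Fin l ⊕ Fin m ≃ Fin v, ∀ r, β (Sum.inr r) = δ r := by
  classical
  have hc : Fintype.card ↥(Set.range δ)ᶜ = l := by
    rw [Fintype.card_compl_set, Fintype.card_fin, Set.card_range_of_injective hδ,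
      Fintype.card_fin]
    omega
  refine ⟨(Equiv.sumComm _ _).trans (((Equiv.ofInjective δ hδ).sumCongr
    (Fintype.equivFinOfCardEq hc).symm).trans (Equiv.Set.sumCompl (Set.range δ))), fun r => ?_⟩
  simp

/-- The digraphs in which prescribed edges `τ r` join prescribed vertices `δ r` and `δ (ρ r)` are
parametrized by the remaining edges. -/
theorem sum_jetWeyl_of_prescribed {k l m v ε : ℕ} (hv : v = l + m) (hε : ε = k + m)
    (h : Fin n → Fin n → ℂ) (φ ψ : Multiset (Idx n) → ℂ) {δ : Fin m → Fin v} {τ : Fin m → Fin ε}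
    (hδ : Function.Injective δ) (hτ : Function.Injective τ) (ρ : Equiv.Perm (Fin m)) :
    ∑ src : Fin ε → Option (Fin v), ∑ tgt : Fin ε → Option (Fin v),
      (if ∀ r, src (τ r) = some (δ r) ∧ tgt (τ r) = some (δ (ρ r)) then
        jetWeyl h φ ψ src tgt else 0) =
    ∑ src : Fin k → Option (Fin l ⊕ Fin m), ∑ tgt : Fin k → Option (Fin l ⊕ Fin m),
      jetWeyl h φ ψ (extendEdges src 1) (extendEdges tgt ρ) := by
  obtain ⟨β, hβ⟩ := exists_sum_equiv_extending hv hδ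
  obtain ⟨γ, hγ⟩ := exists_sum_equiv_extending hε hτ
  set e := γ.arrowCongr (Equiv.optionCongr β) with he
  have hval : ∀ (s : Fin k ⊕ Fin m → Option (Fin l ⊕ Fin m)) (r u : Fin m),
      e s (τ r) = some (δ u) ↔ s (Sum.inr r) = some (Sum.inr u) := by
    intro s r u
    rw [← hγ, ← hβ]
    simp [he, Equiv.arrowCongr]
  have hcond : ∀ (s : Fin k → Option (Fin l ⊕ Fin m)) (s' : Fin m → Option (Fin l ⊕ Fin m))
      (t : Fin k → Option (Fin l ⊕ Fin m)) (t' : Fin m → Option (Fin l ⊕ Fin m)),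
      (∀ r, Sum.elim s s' (Sum.inr r) = some (Sum.inr r) ∧
        Sum.elim t t' (Sum.inr r) = some (Sum.inr (ρ r))) ↔
      (s' = fun r => some (Sum.inr r)) ∧ t' = fun r => some (Sum.inr (ρ r)) := by
    intro s s' t t'
    simp only [Sum.elim_inr, funext_iff, forall_and]
  rw [← e.sum_comp, sum_arrow_sum]
  refine Finset.sum_congr rfl fun s _ => ?_
  have h1 : ∀ s' : Fin m → Option (Fin l ⊕ Fin m),
      (∑ tgt : Fin ε → Option (Fin v), if ∀ r, e (Sum.elim s s') (τ r) = some (δ r) ∧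
        tgt (τ r) = some (δ (ρ r)) then jetWeyl h φ ψ (e (Sum.elim s s')) tgt else 0) =
      if s' = fun r => some (Sum.inr r) then
        ∑ t : Fin k → Option (Fin l ⊕ Fin m),
          jetWeyl h φ ψ (Sum.elim s s') (extendEdges t ρ) else 0 := by
    intro s'
    rw [← e.sum_comp, sum_arrow_sum]
    simp only [hval, hcond, ite_and]
    split_ifs with hs
    · refine Finset.sum_congr rfl fun t _ => ?_
      simp only [he, jetWeyl_equiv]
      rw [Finset.sum_ite_eq' univ (fun r => some (Sum.inr (ρ r))), if_pos (mem_univ _)]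
      rfl
    · simp
  simp only [h1]
  rw [Finset.sum_ite_eq' univ (fun r => some (Sum.inr r)), if_pos (mem_univ _)]
  rfl

/-- The adjacency matrix of the digraph obtained by deleting the distinguished vertex. -/
noncomputable def adjOrdinary {E V : Type*} [Fintype E] [DecidableEq V] (src tgt : E → Option V) :
    Matrix V V ℂ :=
  Matrix.of fun v w => ((univ.filter fun e => src e = some v ∧ tgt e = some w).card : ℂ)

theorem det_adjOrdinary_submatrix {m v ε : ℕ} (src tgt : Fin ε → Option (Fin v))
    (δ : Fin m → Fin v) :
    ((adjOrdinary src tgt).submatrix δ δ).det = ∑ σ : Equiv.Perm (Fin m),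
      ((Equiv.Perm.sign σ : ℤ) : ℂ) * ∑ τ : Fin m → Fin ε,
        if ∀ r, src (τ r) = some (δ r) ∧ tgt (τ r) = some (δ (σ.symm r)) then (1 : ℂ) else 0 := by
  rw [← Matrix.det_transpose, Matrix.det_apply', 
    ← Equiv.sum_comp (Equiv.inv (Equiv.Perm (Fin m)))]
  refine Finset.sum_congr rfl fun σ _ => ?_
  simp only [Equiv.inv_apply, Equiv.Perm.sign_inv]
  congr 1
  simp only [Matrix.transpose_apply, Matrix.submatrix_apply, adjOrdinary, Matrix.of_apply,
    Finset.card_filter, Nat.cast_sum]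
  rw [Finset.prod_univ_sum, Fintype.piFinset_univ]
  refine Finset.sum_congr rfl fun τ _ => ?_
  push_cast
  rw [Finset.prod_ite_zero]
  simp [Equiv.Perm.inv_def]

/-- The sum over edge maps on `k` further edges that accompanies a permutation of `m` vertices. -/
noncomputable def cycleSum (h : Fin n → Fin n → ℂ) (φ ψ : Multiset (Idx n) → ℂ) (k l m : ℕ) : ℂ :=
  ∑ σ : Equiv.Perm (Fin m), ((Equiv.Perm.sign σ : ℤ) : ℂ) *
    ∑ src : Fin k → Option (Fin l ⊕ Fin m), ∑ tgt : Fin k → Option (Fin l ⊕ Fin m),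
      jetWeyl h φ ψ (extendEdges src 1) (extendEdges tgt σ.symm)

theorem sum_det_submatrix_mul_jetWeyl {k l m v ε : ℕ} (hv : v = l + m) (hε : ε = k + m)
    (h : Fin n → Fin n → ℂ) (φ ψ : Multiset (Idx n) → ℂ) {δ : Fin m → Fin v}
    (hδ : Function.Injective δ) :
    ∑ src : Fin ε → Option (Fin v), ∑ tgt : Fin ε → Option (Fin v),
      ((adjOrdinary src tgt).submatrix δ δ).det * jetWeyl h φ ψ src tgt =
    (ε.descFactorial m : ℂ) * cycleSum h φ ψ k l m := by
  simp only [det_adjOrdinary_submatrix, Finset.sum_mul, Finset.mul_sum]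
  have comm : ∀ G : (Fin ε → Option (Fin v)) → (Fin ε → Option (Fin v)) →
      Equiv.Perm (Fin m) → (Fin m → Fin ε) → ℂ,
      ∑ s, ∑ t, ∑ σ, ∑ τ, G s t σ τ = ∑ σ, ∑ τ, ∑ s, ∑ t, G s t σ τ := by
    intro G
    rw [Finset.sum_comm_cycle]
    refine Finset.sum_congr rfl fun σ _ => ?_
    rw [Finset.sum_comm_cycle]
  rw [comm, cycleSum, Finset.mul_sum]
  refine Finset.sum_congr rfl fun σ _ => ?_
  have h1 : ∀ τ : Fin m → Fin ε, ∑ s : Fin ε → Option (Fin v), ∑ t : Fin ε → Option (Fin v),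
      ((Equiv.Perm.sign σ : ℤ) : ℂ) * (if ∀ r, s (τ r) = some (δ r) ∧
        t (τ r) = some (δ (σ.symm r)) then (1 : ℂ) else 0) * jetWeyl h φ ψ s t =
      if Function.Injective τ then ((Equiv.Perm.sign σ : ℤ) : ℂ) *
        ∑ src : Fin k → Option (Fin l ⊕ Fin m), ∑ tgt : Fin k → Option (Fin l ⊕ Fin m),
          jetWeyl h φ ψ (extendEdges src 1) (extendEdges tgt σ.symm) else 0 := by
    intro τ
    split_ifs with hτ
    · rw [← sum_jetWeyl_of_prescribed hv hε h φ ψ hδ hτ σ.symm]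
      simp only [Finset.mul_sum]
      refine Finset.sum_congr rfl fun s _ => Finset.sum_congr rfl fun t _ => ?_
      split_ifs <;> simp
    · -- Edges with different sources are different.
      refine Finset.sum_eq_zero fun s _ => Finset.sum_eq_zero fun t _ => ?_
      rw [if_neg]
      · simp
      · intro hst
        refine hτ fun r r' hr => hδ ?_
        have := (hst r).1.symm.trans ((congrArg s hr).trans (hst r').1)
        simpa using this
  simp only [h1]
  rw [← Finset.sum_filter, Finset.sum_const, nsmul_eq_mul]
  congr 2
  have := Fintype.card_embedding_eq (α := Fin m) (β := Fin ε)
  rw [Fintype.card_fin, Fintype.card_fin] at this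
  rw [← this, ← Fintype.card_subtype]
  exact Fintype.card_congr (Equiv.subtypeInjectiveEquivEmbedding _ _)

/-- Expanding `det (A - 1)` over partial cycle covers: the sum over all labelled digraphs weighted
with `det (A - 1)` is the signed sum over digraphs in which some of the vertices carry a
permutation. -/
theorem sum_det_sub_one_mul_jetWeyl (h : Fin n → Fin n → ℂ) (φ ψ : Multiset (Idx n) → ℂ)
    (j v : ℕ) :
    (((v.factorial : ℂ) * (j + v).factorial)⁻¹ *
      ∑ src : Fin (j + v) → Option (Fin v), ∑ tgt : Fin (j + v) → Option (Fin v),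
        (adjOrdinary src tgt - 1).det * jetWeyl h φ ψ src tgt) =
    ∑ p ∈ antidiagonal v, (((j + p.1).factorial : ℂ) * p.1.factorial * p.2.factorial)⁻¹ *
      ((-1) ^ p.1 * cycleSum h φ ψ (j + p.1) p.1 p.2) := by
  have hdet : ∀ src tgt : Fin (j + v) → Option (Fin v), (adjOrdinary src tgt - 1).det =
      ∑ p ∈ antidiagonal v, (-1) ^ p.1 * ((p.2.factorial : ℂ))⁻¹ *
        ∑ δ : Fin p.2 → Fin v, ((adjOrdinary src tgt).submatrix δ δ).det := by
    intro src tgt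
    have h1 : adjOrdinary src tgt - 1 = -(1 + -adjOrdinary src tgt) := by abel
    rw [h1, Matrix.det_neg, det_one_add_eq_sum _ (v + 1) (by simp), Fintype.card_fin,
      ← Finset.Nat.sum_antidiagonal_eq_sum_range_succ_mk
        (fun p => ((p.1.factorial : ℂ))⁻¹ * ∑ i : Fin p.1 → Fin v,
          ((-adjOrdinary src tgt).submatrix i i).det) v, ← Finset.Nat.sum_antidiagonal_swap,
      Finset.mul_sum]
    refine Finset.sum_congr rfl fun p hp => ?_
    have hp' := Finset.HasAntidiagonal.mem_antidiagonal.1 hp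
    have h2 : ∀ i : Fin p.2 → Fin v, ((-adjOrdinary src tgt).submatrix i i).det =
        (-1) ^ p.2 * ((adjOrdinary src tgt).submatrix i i).det := by
      intro i
      rw [show (-adjOrdinary src tgt).submatrix i i = -((adjOrdinary src tgt).submatrix i i)
        from rfl, Matrix.det_neg, Fintype.card_fin]
    simp only [Prod.fst_swap, h2, ← Finset.mul_sum]
    have h3 : ((-1 : ℂ)) ^ v = (-1) ^ p.1 * (-1) ^ p.2 := by rw [← hp', pow_add]
    have h4 : ((-1 : ℂ)) ^ p.2 * (-1) ^ p.2 = 1 := by rw [← mul_pow]; simp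
    rw [h3]
    linear_combination ((-1 : ℂ)) ^ p.1 * ((p.2.factorial : ℂ))⁻¹ *
      (∑ δ : Fin p.2 → Fin v, ((adjOrdinary src tgt).submatrix δ δ).det) * h4
  simp only [hdet, Finset.sum_mul]
  rw [Finset.sum_comm_cycle, Finset.mul_sum]
  refine Finset.sum_congr rfl fun p hp => ?_
  obtain ⟨l, m⟩ := p
  have hv : l + m = v := Finset.HasAntidiagonal.mem_antidiagonal.1 hp
  subst hv
  have h1 : ∀ δ : Fin m → Fin (l + m), ∑ src : Fin (j + (l + m)) → Option (Fin (l + m)),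
      ∑ tgt : Fin (j + (l + m)) → Option (Fin (l + m)),
        ((adjOrdinary src tgt).submatrix δ δ).det * jetWeyl h φ ψ src tgt =
      if Function.Injective δ then
        ((j + (l + m)).descFactorial m : ℂ) * cycleSum h φ ψ (j + l) l m else 0 := by
    intro δ
    split_ifs with hδ
    · exact sum_det_submatrix_mul_jetWeyl rfl (by omega) h φ ψ hδ
    · refine Finset.sum_eq_zero fun s _ => Finset.sum_eq_zero fun t _ => ?_
      simp only [Function.Injective, not_forall] at hδ
      obtain ⟨r, r', hr, hne⟩ := hδ
      rw [Matrix.det_zero_of_row_eq hne (by funext q; simp [hr]), zero_mul]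
  have h2 : ∑ src : Fin (j + (l + m)) → Option (Fin (l + m)),
      ∑ tgt : Fin (j + (l + m)) → Option (Fin (l + m)),
        (-1) ^ l * ((m.factorial : ℂ))⁻¹ *
          (∑ δ : Fin m → Fin (l + m), ((adjOrdinary src tgt).submatrix δ δ).det) *
            jetWeyl h φ ψ src tgt =
      (-1) ^ l * ((m.factorial : ℂ))⁻¹ * (((l + m).descFactorial m : ℂ) *
        (((j + (l + m)).descFactorial m : ℂ) * cycleSum h φ ψ (j + l) l m)) := by
    have h3 : (((l + m).descFactorial m : ℂ) *
        (((j + (l + m)).descFactorial m : ℂ) * cycleSum h φ ψ (j + l) l m)) =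
        ∑ δ : Fin m → Fin (l + m), ∑ src : Fin (j + (l + m)) → Option (Fin (l + m)),
      ∑ tgt : Fin (j + (l + m)) → Option (Fin (l + m)),
        ((adjOrdinary src tgt).submatrix δ δ).det * jetWeyl h φ ψ src tgt := by
      simp only [h1]
      rw [← Finset.sum_filter, Finset.sum_const, nsmul_eq_mul]
      congr 2
      have := Fintype.card_embedding_eq (α := Fin m) (β := Fin (l + m))
      rw [Fintype.card_fin, Fintype.card_fin] at this
      rw [← this, ← Fintype.card_subtype]
      exact (Fintype.card_congr (Equiv.subtypeInjectiveEquivEmbedding _ _)).symm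
    rw [h3, ← Finset.sum_comm_cycle, Finset.mul_sum]
    refine Finset.sum_congr rfl fun s _ => ?_
    rw [Finset.mul_sum]
    refine Finset.sum_congr rfl fun t _ => ?_
    rw [← Finset.sum_mul]
    ring
  simp only at h2 ⊢
  rw [h2]
  have f1 : (l.factorial : ℂ) * ((l + m).descFactorial m : ℂ) = (l + m).factorial := by
    have := Nat.factorial_mul_descFactorial (n := l + m) (k := m) (by omega)
    rw [Nat.add_sub_cancel] at this
    exact_mod_cast this
  have f2 : ((j + l).factorial : ℂ) * ((j + (l + m)).descFactorial m : ℂ) =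
      (j + (l + m)).factorial := by
    have := Nat.factorial_mul_descFactorial (n := j + (l + m)) (k := m) (by omega)
    rw [show j + (l + m) - m = j + l by omega] at this
    exact_mod_cast this
  have n1 : (l.factorial : ℂ) ≠ 0 := by exact_mod_cast l.factorial_ne_zero
  have n2 : (m.factorial : ℂ) ≠ 0 := by exact_mod_cast m.factorial_ne_zero
  have n3 : ((j + l).factorial : ℂ) ≠ 0 := by exact_mod_cast (j + l).factorial_ne_zero
  have n4 : ((l + m).descFactorial m : ℂ) ≠ 0 := by
    intro h0
    rw [h0, mul_zero] at f1
    exact (Nat.cast_ne_zero (R := ℂ)).2 (l + m).factorial_ne_zero f1.symm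
  have n5 : ((j + (l + m)).descFactorial m : ℂ) ≠ 0 := by
    intro h0
    rw [h0, mul_zero] at f2
    exact (Nat.cast_ne_zero (R := ℂ)).2 (j + (l + m)).factorial_ne_zero f2.symm
  rw [← f1, ← f2]
  field_simp

end Labelled

/-! ### Isomorphism classes -/

namespace PointedDigraph

/-- The composition of isomorphisms. -/
def Iso.comp {Γ Δ Θ : PointedDigraph} (h : Iso Γ Δ) (k : Iso Δ Θ) : Iso Γ Θ where
  vert := h.vert.trans k.vert
  edge := h.edge.trans k.edge
  src_edge e := by simp [k.src_edge, h.src_edge, Option.map_map]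
  tgt_edge e := by simp [k.tgt_edge, h.tgt_edge, Option.map_map]

/-- The inverse of an isomorphism. -/
def Iso.inverse {Γ Δ : PointedDigraph} (h : Iso Γ Δ) : Iso Δ Γ where
  vert := h.vert.symm
  edge := h.edge.symm
  src_edge e := by
    have := h.src_edge (h.edge.symm e)
    rw [Equiv.apply_symm_apply] at this
    rw [this, Option.map_map]; simp
  tgt_edge e := by
    have := h.tgt_edge (h.edge.symm e)
    rw [Equiv.apply_symm_apply] at this
    rw [this, Option.map_map]; simp

instance (Γ Δ : PointedDigraph) : Finite (Iso Γ Δ) :=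
  Finite.of_injective (fun h : Iso Γ Δ => (h.vert, h.edge)) fun h k hk => by
    simp only [Prod.mk.injEq] at hk
    exact Iso.ext hk.1 hk.2

theorem card_iso_congr_right {Γ Δ Θ : PointedDigraph} (h : Iso Δ Θ) :
    Nat.card (Iso Γ Δ) = Nat.card (Iso Γ Θ) :=
  Nat.card_congr ⟨fun k => k.comp h, fun k => k.comp h.inverse,
    fun k => by ext <;> simp [Iso.comp, Iso.inverse],
    fun k => by ext <;> simp [Iso.comp, Iso.inverse]⟩

theorem card_iso_congr_left {Γ Δ Θ : PointedDigraph} (h : Iso Γ Δ) :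
    Nat.card (Iso Γ Θ) = Nat.card (Iso Δ Θ) :=
  Nat.card_congr ⟨fun k => h.inverse.comp k, fun k => h.comp k,
    fun k => by ext <;> simp [Iso.comp, Iso.inverse],
    fun k => by ext <;> simp [Iso.comp, Iso.inverse]⟩

theorem card_aut_iso {Γ Δ : PointedDigraph} (h : Iso Γ Δ) : Nat.card Γ.Aut = Nat.card Δ.Aut :=
  (card_iso_congr_right h).trans (card_iso_congr_left h)

instance (Γ : PointedDigraph) : Nonempty Γ.Aut :=
  ⟨⟨Equiv.refl _, Equiv.refl _, fun e => by simp, fun e => by simp⟩⟩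

theorem card_aut_pos (Γ : PointedDigraph) : 0 < Nat.card Γ.Aut := Nat.card_pos

theorem card_filter_edges_iso {Γ Δ : PointedDigraph} (h : Iso Γ Δ) (P : Fin Δ.numE → Prop)
    [DecidablePred P] :
    (univ.filter fun e => P (h.edge e)).card = (univ.filter P).card := by
  rw [← Finset.card_map h.edge.toEmbedding]
  congr 1
  ext e
  obtain ⟨e, rfl⟩ := h.edge.surjective e
  simp

theorem outDeg_iso {Γ Δ : PointedDigraph} (h : Iso Γ Δ) (v : Option (Fin Γ.numV)) :
    Γ.outDeg v = Δ.outDeg (v.map h.vert) := by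
  have inj := Option.map_injective h.vert.injective
  rw [outDeg, outDeg, ← card_filter_edges_iso h]
  simp only [h.src_edge, inj.eq_iff]

theorem inDeg_iso {Γ Δ : PointedDigraph} (h : Iso Γ Δ) (v : Option (Fin Γ.numV)) :
    Γ.inDeg v = Δ.inDeg (v.map h.vert) := by
  have inj := Option.map_injective h.vert.injective
  rw [inDeg, inDeg, ← card_filter_edges_iso h]
  simp only [h.tgt_edge, inj.eq_iff]

theorem adjMinus_iso {Γ Δ : PointedDigraph} (h : Iso Γ Δ) :
    Γ.adjMinus = Δ.adjMinus.submatrix h.vert h.vert := by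
  have inj := Option.map_injective h.vert.injective
  ext v w
  simp only [adjMinus, Matrix.of_apply, Matrix.submatrix_apply]
  rw [← card_filter_edges_iso h]
  have e : ∀ v, some (h.vert v) = (some v).map h.vert := fun v => rfl
  simp only [e, h.tgt_edge, h.src_edge, inj.eq_iff]

theorem det_adjMinus_iso {Γ Δ : PointedDigraph} (h : Iso Γ Δ) :
    (Γ.adjMinus - 1).det = (Δ.adjMinus - 1).det := by
  rw [adjMinus_iso h, ← Matrix.det_submatrix_equiv_self h.vert (Δ.adjMinus - 1),
    Matrix.submatrix_sub]
  simp

theorem numV_iso {Γ Δ : PointedDigraph} (h : Iso Γ Δ) : Γ.numV = Δ.numV := by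
  simpa using Fintype.card_congr h.vert

theorem numE_iso {Γ Δ : PointedDigraph} (h : Iso Γ Δ) : Γ.numE = Δ.numE := by
  simpa using Fintype.card_congr h.edge

theorem IsSemistable.iso {Γ Δ : PointedDigraph} (h : Iso Γ Δ) (hΓ : Γ.IsSemistable) :
    Δ.IsSemistable := by
  intro v
  obtain ⟨v, rfl⟩ := h.vert.surjective v
  have := hΓ v
  rwa [inDeg_iso h, outDeg_iso h] at this

theorem mk_mem_semistableClasses {Γ : PointedDigraph} {j : ℕ} :
    (⟦Γ⟧ : IsoClass) ∈ semistableClasses j ↔ Γ.IsSemistable ∧ Γ.weight = j := by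
  rw [semistableClasses, Set.Finite.mem_toFinset, Set.mem_ofPred_eq]
  constructor
  · rintro ⟨Δ, h1, h2, h3⟩
    obtain ⟨i⟩ := Quotient.exact h3
    refine ⟨h1.iso i, ?_⟩
    rw [← h2, weight, weight, numV_iso i, numE_iso i]
  · rintro ⟨h1, h2⟩
    exact ⟨Γ, h1, h2, rfl⟩

/-- The coefficient `det (A(Γ₋) - 1) / |Aut Γ|` of an isomorphism class. -/
noncomputable def IsoClass.coeff (q : IsoClass) : ℂ :=
  Quotient.lift (s := isoSetoid)
    (fun Γ : PointedDigraph => ((Γ.adjMinus - 1).det : ℂ) / (Nat.card Γ.Aut : ℂ))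
    (fun Γ Δ (h : Nonempty (Iso Γ Δ)) => h.elim fun i => by
      rw [det_adjMinus_iso i, card_aut_iso i]) q

theorem sum_card_iso_self (Γ : PointedDigraph) :
    ∑ s : Fin Γ.numE → Option (Fin Γ.numV), ∑ t : Fin Γ.numE → Option (Fin Γ.numV),
      Nat.card (Iso Γ ⟨Γ.numV, Γ.numE, s, t⟩) = Γ.numV.factorial * Γ.numE.factorial := by
  have h : (Σ p : (Fin Γ.numE → Option (Fin Γ.numV)) × (Fin Γ.numE → Option (Fin Γ.numV)),
      Iso Γ ⟨Γ.numV, Γ.numE, p.1, p.2⟩) ≃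
      Equiv.Perm (Fin Γ.numV) × Equiv.Perm (Fin Γ.numE) :=
    { toFun := fun q => (q.2.vert, q.2.edge)
      invFun := fun q => ⟨(fun e => (Γ.src (q.2.symm e)).map q.1,
        fun e => (Γ.tgt (q.2.symm e)).map q.1),
        ⟨q.1, q.2, fun e => by simp, fun e => by simp⟩⟩
      left_inv := by
        rintro ⟨⟨s, t⟩, ⟨β, γ, hs, ht⟩⟩
        change Equiv.Perm (Fin Γ.numV) at β
        change Equiv.Perm (Fin Γ.numE) at γ
        change ∀ e, s (γ e) = (Γ.src e).map β at hs
        change ∀ e, t (γ e) = (Γ.tgt e).map β at ht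
        have h1 : s = fun e => (Γ.src (γ.symm e)).map β := by
          funext e; rw [← hs]; simp
        have h2 : t = fun e => (Γ.tgt (γ.symm e)).map β := by
          funext e; rw [← ht]; simp
        subst h1 h2
        rfl
      right_inv := fun q => rfl }
  have hc := Nat.card_congr h
  rw [Nat.card_prod, Nat.card_sigma, Fintype.sum_prod_type] at hc
  rw [hc, Nat.card_eq_fintype_card, Nat.card_eq_fintype_card, Fintype.card_perm,
    Fintype.card_perm, Fintype.card_fin, Fintype.card_fin]

open Classical in
/-- Orbit counting: `1 / |Aut Γ|` is the weighted number of labelled digraphs isomorphic to `Γ`. -/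
theorem inv_card_aut_eq_sum {Γ : PointedDigraph} {j : ℕ} (hE : Γ.numE = j + Γ.numV)
    (hV : Γ.numV ≤ 2 * j) :
    ((Nat.card Γ.Aut : ℂ))⁻¹ = ∑ v ∈ range (2 * j + 1),
      (((v.factorial : ℂ) * (j + v).factorial)⁻¹ *
        ∑ s : Fin (j + v) → Option (Fin v), ∑ t : Fin (j + v) → Option (Fin v),
          if (⟦⟨v, j + v, s, t⟩⟧ : IsoClass) = ⟦Γ⟧ then (1 : ℂ) else 0) := by
  have hA : (Nat.card Γ.Aut : ℂ) ≠ 0 := by exact_mod_cast (card_aut_pos Γ).ne'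
  have hind : ∀ Δ : PointedDigraph, (if (⟦Δ⟧ : IsoClass) = ⟦Γ⟧ then (1 : ℂ) else 0) =
      (Nat.card Γ.Aut : ℂ)⁻¹ * (Nat.card (Iso Γ Δ) : ℂ) := by
    intro Δ
    split_ifs with h
    · obtain ⟨i⟩ := Quotient.exact h
      rw [← card_iso_congr_right i.inverse, inv_mul_cancel₀ hA]
    · have : IsEmpty (Iso Γ Δ) := ⟨fun i => h (Quotient.sound ⟨i.inverse⟩)⟩
      simp
  simp only [hind, ← Finset.mul_sum]
  obtain ⟨V, E, s₀, t₀⟩ := Γ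
  simp only at hE hV
  subst hE
  rw [Finset.sum_eq_single V]
  · have := sum_card_iso_self ⟨V, j + V, s₀, t₀⟩
    simp only at this
    have h2 : ∑ s : Fin (j + V) → Option (Fin V), ∑ t : Fin (j + V) → Option (Fin V),
        (Nat.card (Iso ⟨V, j + V, s₀, t₀⟩ ⟨V, j + V, s, t⟩) : ℂ) =
        (V.factorial : ℂ) * (j + V).factorial := by exact_mod_cast this
    rw [h2]
    have n1 : (V.factorial : ℂ) ≠ 0 := by exact_mod_cast V.factorial_ne_zero
    have n2 : ((j + V).factorial : ℂ) ≠ 0 := by exact_mod_cast (j + V).factorial_ne_zero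
    field_simp
  · intro v _ hv
    have h0 : ∀ s t, Nat.card (Iso ⟨V, j + V, s₀, t₀⟩ ⟨v, j + v, s, t⟩) = 0 := fun s t => by
      have : IsEmpty (Iso ⟨V, j + V, s₀, t₀⟩ ⟨v, j + v, s, t⟩) := ⟨fun i => hv (numV_iso i).symm⟩
      simp
    simp [h0]
  · intro h
    exact absurd (Finset.mem_range.2 (by omega)) h

open Classical in
/-- A sum over isomorphism classes, weighted with `1 / |Aut Γ|`, as a sum over labelled digraphs. -/
theorem sum_semistableClasses_eq (j : ℕ) (D : PointedDigraph → ℂ)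
    (hD : ∀ Γ Δ, Nonempty (Iso Γ Δ) → D Γ = D Δ) (G : IsoClass → ℂ)
    (hG : ∀ Γ : PointedDigraph, G ⟦Γ⟧ = D Γ * ((Nat.card Γ.Aut : ℂ))⁻¹) :
    ∑ q ∈ semistableClasses j, G q = ∑ v ∈ range (2 * j + 1),
      (((v.factorial : ℂ) * (j + v).factorial)⁻¹ *
        ∑ s : Fin (j + v) → Option (Fin v), ∑ t : Fin (j + v) → Option (Fin v),
          if IsSemistable ⟨v, j + v, s, t⟩ then D ⟨v, j + v, s, t⟩ else 0) := by
  have h1 : ∀ q ∈ semistableClasses j, G q = ∑ v ∈ range (2 * j + 1),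
      ∑ s : Fin (j + v) → Option (Fin v), ∑ t : Fin (j + v) → Option (Fin v),
        if (⟦⟨v, j + v, s, t⟩⟧ : IsoClass) = q then
          (((v.factorial : ℂ) * (j + v).factorial)⁻¹ * D ⟨v, j + v, s, t⟩) else 0 := by
    intro q hq
    obtain ⟨Γ, rfl⟩ := Quotient.exists_rep q
    obtain ⟨hs, hw⟩ := mk_mem_semistableClasses.1 hq
    have h3 := hs.three_mul_numV_le
    rw [weight] at hw
    rw [hG, inv_card_aut_eq_sum (j := j) (by omega) (by omega)]
    simp only [Finset.mul_sum]
    refine Finset.sum_congr rfl fun v _ => Finset.sum_congr rfl fun s _ =>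
      Finset.sum_congr rfl fun t _ => ?_
    split_ifs with h
    · rw [hD Γ _ (Quotient.exact h.symm)]
      ring
    · simp
  rw [Finset.sum_congr rfl h1, Finset.sum_comm]
  refine Finset.sum_congr rfl fun v _ => ?_
  rw [Finset.sum_comm, Finset.mul_sum]
  refine Finset.sum_congr rfl fun s _ => ?_
  rw [Finset.sum_comm, Finset.mul_sum]
  refine Finset.sum_congr rfl fun t _ => ?_
  rw [Finset.sum_ite_eq]
  have : (⟦⟨v, j + v, s, t⟩⟧ : IsoClass) ∈ semistableClasses j ↔
      IsSemistable ⟨v, j + v, s, t⟩ := by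
    rw [mk_mem_semistableClasses, weight]
    simp
  simp only [this]
  split_ifs <;> simp

end PointedDigraph

/-! ### The expansion over isomorphism classes -/

section Expansion

variable {n : ℕ}

theorem card_halves {E W : Type*} [Fintype E] [DecidableEq W] (src tgt : E → W) (a b : E → Fin n)
    (w : W) : (halves src tgt a b w).card =
      (univ.filter fun e => src e = w).card + (univ.filter fun e => tgt e = w).card := by
  simp [halves, Finset.card_def]

theorem countP_isLeft_halves {E W : Type*} [Fintype E] [DecidableEq W] (src tgt : E → W)
    (a b : E → Fin n) (w : W) : (halves src tgt a b w).countP (fun α => α.isLeft) =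
      (univ.filter fun e => src e = w).card := by
  simp [halves, Multiset.countP_map, Finset.card_def]

theorem countP_isRight_halves {E W : Type*} [Fintype E] [DecidableEq W] (src tgt : E → W)
    (a b : E → Fin n) (w : W) : (halves src tgt a b w).countP (fun α => α.isRight) =
      (univ.filter fun e => tgt e = w).card := by
  simp [halves, Multiset.countP_map, Finset.card_def]

theorem sum_card_fiber_some_le {E V : Type*} [Fintype E] [Fintype V] [DecidableEq V]
    (s : E → Option V) :
    ∑ v : V, (univ.filter fun e => s e = some v).card ≤ Fintype.card E := by
  classical
  rw [← Finset.card_biUnion]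
  · exact Finset.card_le_univ _
  · intro v _ w _ hvw
    refine Finset.disjoint_filter.2 fun e _ h1 h2 => hvw ?_
    simpa using h1.symm.trans h2

theorem jetWeyl_eq_zero {E V : Type*} [Fintype E] [DecidableEq E] [Fintype V] [DecidableEq V]
    (h : Fin n → Fin n → ℂ) {φ : Multiset (Idx n) → ℂ} (ψ : Multiset (Idx n) → ℂ)
    (hφ : ∀ s, ¬ IsStable s → φ s = 0) (src tgt : E → Option V)
    (hc : 2 * Fintype.card E < 3 * Fintype.card V) : jetWeyl h φ ψ src tgt = 0 := by
  refine Finset.sum_eq_zero fun a _ => Finset.sum_eq_zero fun b _ => ?_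
  suffices h0 : ∃ v, φ (halves src tgt a b (some v)) = 0 by
    obtain ⟨v, hv⟩ := h0
    rw [Finset.prod_eq_zero (mem_univ v) hv]
    ring
  by_contra! hne
  have h1 : ∀ v, 3 ≤ (halves src tgt a b (some v)).card := fun v => by
    by_contra hlt
    exact hne v (hφ _ fun hs => hlt hs.2.2)
  have h2 := Finset.sum_le_sum fun v (_ : v ∈ (univ : Finset V)) => h1 v
  simp only [card_halves, Finset.sum_add_distrib] at h2
  have h3 := sum_card_fiber_some_le src
  have h4 := sum_card_fiber_some_le tgt
  simp at h2
  omega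

theorem stableJet_of_not_isStable {Φ : (Fin n → ℂ) → ℝ} {x : Fin n → ℂ} (s : Multiset (Idx n))
    (hs : ¬ IsStable s) : stableJet Φ x s = 0 := if_neg hs

open Classical in
theorem jetWeyl_stableJet (Γ : PointedDigraph) (Φ : (Fin n → ℂ) → ℝ) (f : (Fin n → ℂ) → ℂ)
    (x : Fin n → ℂ) :
    jetWeyl (invMetric Φ x) (stableJet Φ x) (fun s => wirtMultiset s f x) Γ.src Γ.tgt =
      if Γ.IsSemistable then Γ.weyl Φ f x else 0 := by
  have hst : ∀ (a b : Fin Γ.numE → Fin n) (v : Fin Γ.numV),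
      IsStable (halves Γ.src Γ.tgt a b (some v)) ↔ (1 ≤ Γ.inDeg (some v) ∧
        1 ≤ Γ.outDeg (some v) ∧ 3 ≤ Γ.inDeg (some v) + Γ.outDeg (some v)) := by
    intro a b v
    rw [IsStable, countP_isLeft_halves, countP_isRight_halves, card_halves]
    simp only [PointedDigraph.inDeg, PointedDigraph.outDeg]
    omega
  split_ifs with h
  · refine Finset.sum_congr rfl fun a _ => Finset.sum_congr rfl fun b _ => ?_
    have : ∀ v : Fin Γ.numV, stableJet Φ x (halves Γ.src Γ.tgt a b (some v)) =
        wirtMultiset (Γ.halfEdges a b (some v)) (fun w => (Φ w : ℂ)) x := fun v =>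
      if_pos ((hst a b v).2 (h v))
    simp only [this]
    rfl
  · simp only [PointedDigraph.IsSemistable, not_forall] at h
    obtain ⟨v, hv⟩ := h
    refine Finset.sum_eq_zero fun a _ => Finset.sum_eq_zero fun b _ => ?_
    rw [Finset.prod_eq_zero (mem_univ v)
      (stableJet_of_not_isStable _ fun hs => hv ((hst a b v).1 hs))]
    ring

theorem sum_range_range_eq_sum_antidiagonal (N M : ℕ) (hM : N ≤ M) (G : ℕ → ℕ → ℂ)
    (hG : ∀ l m, N ≤ l + m → G l m = 0) :
    ∑ l ∈ range N, ∑ m ∈ range M, G l m =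
      ∑ v ∈ range N, ∑ p ∈ antidiagonal v, G p.1 p.2 := by
  rw [← Finset.sum_product' (range N) (range M) G]
  have h1 : ∑ p ∈ range N ×ˢ range M, G p.1 p.2 =
      ∑ p ∈ (range N ×ˢ range M).filter (fun p => p.1 + p.2 < N), G p.1 p.2 := by
    refine (Finset.sum_filter_of_ne fun p _ hne => ?_).symm
    by_contra hlt
    exact hne (hG _ _ (by omega))
  rw [h1, ← Finset.sum_fiberwise_of_maps_to (t := range N) (g := fun p => p.1 + p.2)
    (fun p hp => by simpa using (Finset.mem_filter.1 hp).2)]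
  refine Finset.sum_congr rfl fun v hv => Finset.sum_congr ?_ fun _ _ => rfl
  ext ⟨l, m⟩
  have := Finset.mem_range.1 hv
  simp only [Finset.mem_filter, Finset.mem_product, Finset.mem_range,
    HasAntidiagonal.mem_antidiagonal]
  omega

/-- The expansion of `R_j` with the coefficients `det (A(Γ₋) - 1) / |Aut Γ|`. -/
theorem englisR_eq_sum_coeff {Φ : (Fin n → ℂ) → ℝ} {x : Fin n → ℂ} {f S : (Fin n → ℂ) → ℂ}
    (hΦ : ContDiffAt ℝ ∞ (fun w => (Φ w : ℂ)) x) (hf : ContDiffAt ℝ ∞ f x)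
    (hS : IsPhaseRemainder Φ x S) (hG : IsUnit (metric Φ x).det) (j : ℕ) :
    englisR Φ S j f x = ∑ q ∈ PointedDigraph.semistableClasses j,
      q.coeff * PointedDigraph.IsoClass.weyl Φ f x q := by
  classical
  -- The bound `n + 2 * j + 1` exceeds the size of the metric, as the determinant expansion requires,
  -- and leaves room for every pair with `l + m ≤ 2 * j`; a stable digraph has no more vertices.
  refine (englisR_eq_sum hΦ hf hS hG j (n + 2 * j + 1) (by omega)).trans
    ((sum_range_range_eq_sum_antidiagonal (2 * j + 1) (n + 2 * j + 1) (by omega)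
      (fun l m => (((j + l).factorial : ℂ) * l.factorial * m.factorial)⁻¹ *
      ((-1) ^ l * cycleSum (invMetric Φ x) (stableJet Φ x) (fun s => wirtMultiset s f x)
        (j + l) l m)) ?_).trans ?_)
  rotate_left
  · rw [PointedDigraph.sum_semistableClasses_eq j
      (fun Γ => ((Γ.adjMinus - 1).det : ℂ) * Γ.weyl Φ f x)]
    · refine Finset.sum_congr rfl fun v _ => ?_
      rw [← sum_det_sub_one_mul_jetWeyl]
      congr 1
      refine Finset.sum_congr rfl fun s _ => Finset.sum_congr rfl fun t _ => ?_
      have h1 := jetWeyl_stableJet ⟨v, j + v, s, t⟩ Φ f x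
      simp only at h1
      rw [h1]
      have h2 : (adjOrdinary s t - 1).det =
          (((PointedDigraph.adjMinus ⟨v, j + v, s, t⟩ - 1).det : ℤ) : ℂ) := by
        rw [← eq_intCast (Int.castRingHom ℂ), RingHom.map_det]
        congr 1
        ext p q
        by_cases hpq : p = q <;>
          simp [adjOrdinary, PointedDigraph.adjMinus, hpq]
      rw [h2]
      split_ifs <;> simp
    · rintro Γ Δ ⟨i⟩
      rw [PointedDigraph.det_adjMinus_iso i, PointedDigraph.weyl_iso i]
    · intro Γ
      change ((Γ.adjMinus - 1).det : ℂ) / (Nat.card Γ.Aut : ℂ) * Γ.weyl Φ f x = _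
      ring
  · intro l m hlm
    have : cycleSum (invMetric Φ x) (stableJet Φ x) (fun s => wirtMultiset s f x)
        (j + l) l m = 0 := by
      refine Finset.sum_eq_zero fun σ _ => ?_
      rw [Finset.sum_eq_zero, mul_zero]
      refine fun s _ => Finset.sum_eq_zero fun t _ => ?_
      refine jetWeyl_eq_zero _ _ stableJet_of_not_isStable _ _ ?_
      simp
      omega
    rw [this]
    ring

end Expansion

/-! ### Kähler potentials with prescribed polynomial jets -/

section Monomials

variable {n : ℕ}

/-- The coordinate functions `zᵢ` and `z̄ᵢ`. -/
def coordFun : Idx n → (Fin n → ℂ) → ℂ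
  | Sum.inl i, z => z i
  | Sum.inr i, z => (starRingEnd ℂ) (z i)

/-- The multilinear monomial in the coordinates `zᵢ`, `z̄ᵢ` with indices in `s`. -/
def monomialFun (s : Finset (Idx n)) (z : Fin n → ℂ) : ℂ := ∏ α ∈ s, coordFun α z

theorem contDiff_coordFun (α : Idx n) : ContDiff ℝ ∞ (coordFun α) := by
  rcases α with i | i
  · exact contDiff_apply ℝ ℂ i
  · exact Complex.conjCLE.contDiff.comp (contDiff_apply ℝ ℂ i)

theorem contDiff_monomialFun (s : Finset (Idx n)) : ContDiff ℝ ∞ (monomialFun s) :=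
  contDiff_prod fun α _ => contDiff_coordFun α

theorem wirt_coordFun (α β : Idx n) (z : Fin n → ℂ) :
    wirt α (coordFun β) z = if α = β then 1 else 0 := by
  have h1 : ∀ i : Fin n, HasFDerivAt (fun w : Fin n → ℂ => w i)
      (ContinuousLinearMap.proj (R := ℝ) (φ := fun _ : Fin n => ℂ) i) z := fun i =>
    hasFDerivAt_apply i z
  rcases β with j | j
  · have h2 : fderiv ℝ (coordFun (Sum.inl j)) z = _ := (h1 j).fderiv
    rcases α with i | i
    all_goals
      by_cases hij : i = j
      · subst hij
        simp [wirt, h2]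
      · simp [wirt, h2, Ne.symm hij, eq_comm]
  · have h2 : fderiv ℝ (coordFun (Sum.inr j)) z = _ :=
      (Complex.conjCLE.hasFDerivAt.comp z (h1 j)).fderiv
    rcases α with i | i
    all_goals
      by_cases hij : i = j
      · subst hij
        simp [wirt, h2]
      · simp [wirt, h2, Ne.symm hij, eq_comm]

theorem wirt_monomialFun (α : Idx n) (s : Finset (Idx n)) :
    wirt α (monomialFun s) = if α ∈ s then monomialFun (s.erase α) else fun _ => 0 := by
  funext z
  have h := (wirt_prod (x := z) s (fun β => coordFun β)
    (fun β _ => (contDiff_coordFun β).contDiffAt) α).self_of_nhds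
  change wirt α (monomialFun s) z = _ at h
  rw [h]
  simp only [wirt_coordFun, mul_ite, mul_one, mul_zero, Finset.sum_ite_eq]
  split_ifs <;> rfl

theorem wirtList_zero (l : List (Idx n)) :
    wirtList l (fun _ : Fin n → ℂ => (0 : ℂ)) = fun _ => 0 := by
  induction l with
  | nil => rfl
  | cons α l ih =>
    change wirt α (wirtList l _) = _
    rw [ih, wirt_const]

theorem wirtList_monomialFun (l : List (Idx n)) : ∀ s : Finset (Idx n),
    wirtList l (monomialFun s) 0 = if (l : Multiset (Idx n)) = s.val then 1 else 0 := by
  induction l using List.reverseRecOn with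
  | nil =>
    intro s
    rcases s.eq_empty_or_nonempty with rfl | ⟨α, hα⟩
    · simp [wirtList, monomialFun]
    · rw [if_neg]
      · change monomialFun s 0 = 0
        refine Finset.prod_eq_zero hα ?_
        rcases α with i | i <;> simp [coordFun]
      · intro h
        have : α ∈ s.val := hα
        rw [← h] at this
        simp at this
  | append_singleton l α ih =>
    intro s
    rw [wirtList_append]
    change wirtList l (wirt α (monomialFun s)) 0 = _
    rw [wirt_monomialFun]
    have hc : ((l ++ [α] : List (Idx n)) : Multiset (Idx n)) = α ::ₘ (l : Multiset (Idx n)) := by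
      rw [← Multiset.coe_add, add_comm]; rfl
    rw [hc]
    by_cases hα : α ∈ s
    · rw [if_pos hα, ih, Finset.erase_val]
      congr 1
      apply propext
      constructor
      · intro h
        rw [h, Multiset.cons_erase hα]
      · intro h
        rw [← h, Multiset.erase_cons_head]
    · rw [if_neg hα, wirtList_zero, if_neg]
      intro h
      exact hα (by rw [← Finset.mem_val, ← h]; simp)

theorem conj_coordFun (α : Idx n) (z : Fin n → ℂ) :
    (starRingEnd ℂ) (coordFun α z) = coordFun α.swap z := by
  rcases α with i | i <;> simp [coordFun]

/-- The set of conjugate indices. -/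
def conjSet (s : Finset (Idx n)) : Finset (Idx n) :=
  s.map (Equiv.sumComm (Fin n) (Fin n)).toEmbedding

theorem conj_monomialFun (s : Finset (Idx n)) (z : Fin n → ℂ) :
    (starRingEnd ℂ) (monomialFun s z) = monomialFun (conjSet s) z := by
  simp only [monomialFun, conjSet, Finset.prod_map, map_prod, conj_coordFun]
  rfl

theorem conjSet_conjSet (s : Finset (Idx n)) : conjSet (conjSet s) = s := by
  ext α
  simp [conjSet]

/-- A linear combination of multilinear monomials. -/
def monomialSum {κ : Type*} [Fintype κ] (c : κ → ℂ) (s : κ → Finset (Idx n)) (z : Fin n → ℂ) : ℂ :=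
  ∑ i, c i * monomialFun (s i) z

theorem contDiff_monomialSum {κ : Type*} [Fintype κ] (c : κ → ℂ) (s : κ → Finset (Idx n)) :
    ContDiff ℝ ∞ (monomialSum c s) :=
  ContDiff.sum fun i _ => contDiff_const.mul (contDiff_monomialFun (s i))

theorem wirtList_monomialSum {κ : Type*} [Fintype κ] (c : κ → ℂ) (s : κ → Finset (Idx n))
    (l : List (Idx n)) : wirtList l (monomialSum c s) 0 =
      ∑ i, if (l : Multiset (Idx n)) = (s i).val then c i else 0 := by
  have h := (wirtList_linear_combination (x := 0) c (fun i => monomialFun (s i))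
    (fun i => (contDiff_monomialFun (s i)).contDiffAt) l).self_of_nhds
  change wirtList l (monomialSum c s) 0 = _ at h
  rw [h]
  simp only [wirtList_monomialFun, mul_ite, mul_one, mul_zero]

end Monomials

section Metric

variable {n : ℕ}

theorem conj_wirt (α : Idx n) (u : (Fin n → ℂ) → ℂ) (z : Fin n → ℂ) :
    (starRingEnd ℂ) (wirt α u z) = wirt α.swap (fun w => (starRingEnd ℂ) (u w)) z := by
  have h : fderiv ℝ (fun w => (starRingEnd ℂ) (u w)) z =
      (Complex.conjCLE : ℂ →L[ℝ] ℂ).comp (fderiv ℝ u z) := Complex.conjCLE.comp_fderiv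
  rcases α with i | i <;> simp [wirt, h, sub_eq_add_neg, map_ofNat]

theorem isHermitian_metric {Φ : (Fin n → ℂ) → ℝ} {z : Fin n → ℂ}
    (hΦ : ContDiffAt ℝ ∞ (fun w => (Φ w : ℂ)) z) : (metric Φ z).IsHermitian := by
  ext i j
  rw [Matrix.conjTranspose_apply]
  change (starRingEnd ℂ) (wirt (Sum.inl j) (wirt (Sum.inr i) fun w => (Φ w : ℂ)) z) =
    wirt (Sum.inl i) (wirt (Sum.inr j) fun w => (Φ w : ℂ)) z
  rw [conj_wirt]
  have h : (fun w => (starRingEnd ℂ) (wirt (Sum.inr i) (fun w => (Φ w : ℂ)) w)) =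
      wirt (Sum.inl i) fun w => (Φ w : ℂ) := by
    funext w
    rw [conj_wirt]
    simp
  rw [h]
  exact (wirt_comm hΦ _ _).self_of_nhds

theorem posDef_of_isHermitian_of_near_one {G : Matrix (Fin n) (Fin n) ℂ} (hG : G.IsHermitian)
    (hn : ∀ i j, ‖G i j - (1 : Matrix (Fin n) (Fin n) ℂ) i j‖ ≤ ((n : ℝ) + 1)⁻¹) : G.PosDef := by
  refine Matrix.PosDef.of_dotProduct_mulVec_pos hG fun x hx => ?_
  rw [Complex.lt_def]
  refine ⟨?_, ?_⟩
  swap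
  · exact (hG.im_star_dotProduct_mulVec_self x).symm
  have h1 : star x ⬝ᵥ G.mulVec x = ((∑ i, ‖x i‖ ^ 2 : ℝ) : ℂ) +
      ∑ i, ∑ j, star (x i) * (G i j - (1 : Matrix (Fin n) (Fin n) ℂ) i j) * x j := by
    have h2 : G.mulVec x = x + (G - 1).mulVec x := by
      rw [Matrix.sub_mulVec, Matrix.one_mulVec]; abel
    rw [h2, dotProduct_add]
    congr 1
    · rw [dotProduct]
      push_cast
      refine Finset.sum_congr rfl fun i _ => ?_
      rw [Pi.star_apply, Complex.star_def, Complex.conj_mul']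
    · simp only [dotProduct, Matrix.mulVec, Finset.mul_sum, Pi.star_apply, Matrix.sub_apply,
        mul_assoc]
  have h3 : ‖∑ i, ∑ j, star (x i) * (G i j - (1 : Matrix (Fin n) (Fin n) ℂ) i j) * x j‖ ≤
      ((n : ℝ) + 1)⁻¹ * (∑ i, ‖x i‖) ^ 2 := by
    rw [sq, Finset.sum_mul_sum, Finset.mul_sum]
    refine (norm_sum_le _ _).trans (Finset.sum_le_sum fun i _ => ?_)
    rw [Finset.mul_sum]
    refine (norm_sum_le _ _).trans (Finset.sum_le_sum fun j _ => ?_)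
    rw [norm_mul, norm_mul, norm_star]
    have := mul_le_mul_of_nonneg_right (hn i j) (mul_nonneg (norm_nonneg (x i)) (norm_nonneg (x j)))
    linarith
  have h4 : (∑ i, ‖x i‖) ^ 2 ≤ (n : ℝ) * ∑ i, ‖x i‖ ^ 2 := by
    simpa using sq_sum_le_card_mul_sum_sq (s := univ) (f := fun i => ‖x i‖)
  have h5 : 0 < ∑ i, ‖x i‖ ^ 2 := by
    obtain ⟨i, hi⟩ := Function.ne_iff.1 hx
    refine Finset.sum_pos' (fun i _ => sq_nonneg _) ⟨i, mem_univ _, ?_⟩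
    have : 0 < ‖x i‖ := norm_pos_iff.2 hi
    positivity
  have h6 : ((n : ℝ) + 1)⁻¹ * (∑ i, ‖x i‖) ^ 2 < ∑ i, ‖x i‖ ^ 2 := by
    have hp : (0 : ℝ) < (n : ℝ) + 1 := by positivity
    rw [inv_mul_lt_iff₀ hp]
    nlinarith
  have h7 := Complex.abs_re_le_norm
    (∑ i, ∑ j, star (x i) * (G i j - (1 : Matrix (Fin n) (Fin n) ℂ) i j) * x j)
  have h8 := neg_abs_le
    (∑ i, ∑ j, star (x i) * (G i j - (1 : Matrix (Fin n) (Fin n) ℂ) i j) * x j).re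
  rw [h1, Complex.add_re, Complex.ofReal_re, Complex.zero_re]
  linarith

/-- A smooth function whose metric at a point is the identity is a Kähler potential nearby. -/
theorem exists_isKahlerPotential {Φ : (Fin n → ℂ) → ℝ} {x : Fin n → ℂ} (hΦ : ContDiff ℝ ∞ Φ)
    (h1 : metric Φ x = 1) :
    ∃ U : Set (Fin n → ℂ), IsOpen U ∧ x ∈ U ∧ IsKahlerPotential Φ U := by
  have hc : ∀ z, ContDiffAt ℝ ∞ (fun w => (Φ w : ℂ)) z := fun z =>
    (Complex.ofRealCLM.contDiff.comp hΦ).contDiffAt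
  have hev : ∀ᶠ z in 𝓝 x, ∀ i j, ‖metric Φ z i j - (1 : Matrix (Fin n) (Fin n) ℂ) i j‖ ≤
      ((n : ℝ) + 1)⁻¹ := by
    refine eventually_all.2 fun i => eventually_all.2 fun j => ?_
    have h2 : ContinuousAt (fun z => ‖metric Φ z i j - (1 : Matrix (Fin n) (Fin n) ℂ) i j‖) x :=
      ((contDiffAt_metric (hc x) i j).continuousAt.sub continuousAt_const).norm
    have h3 : ‖metric Φ x i j - (1 : Matrix (Fin n) (Fin n) ℂ) i j‖ < ((n : ℝ) + 1)⁻¹ := by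
      rw [h1, sub_self, norm_zero]
      positivity
    exact (h2.eventually_lt continuousAt_const h3).mono fun z hz => hz.le
  obtain ⟨U, hU, hUo, hxU⟩ := eventually_nhds_iff.1 hev
  exact ⟨U, hUo, hxU, hΦ.contDiffOn, fun z hz =>
    posDef_of_isHermitian_of_near_one (isHermitian_metric (hc z)) (hU z hz)⟩

end Metric

section TestPotential

variable {n : ℕ} {κ : Type*} [Fintype κ]

/-- Half of the coefficients belong to the monomials `s i`, the other half to their conjugates. -/
def conjCoeff (t : κ → ℂ) : κ ⊕ κ → ℂ := Sum.elim t fun i => (starRingEnd ℂ) (t i)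

/-- The monomials `s i` and their conjugates. -/
def conjFamily (s : κ → Finset (Idx n)) : κ ⊕ κ → Finset (Idx n) :=
  Sum.elim s fun i => conjSet (s i)

/-- The potential `|z|² + 2 Re ∑ tᵢ z^{sᵢ}`. -/
def testPotential (t : κ → ℂ) (s : κ → Finset (Idx n)) (z : Fin n → ℂ) : ℝ :=
  (∑ i, z i * (starRingEnd ℂ) (z i) + monomialSum (conjCoeff t) (conjFamily s) z).re

theorem testPotential_eq (t : κ → ℂ) (s : κ → Finset (Idx n)) :
    (fun z => (testPotential t s z : ℂ)) = monomialSum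
      (Sum.elim (fun _ : Fin n => 1) (conjCoeff t))
      (Sum.elim (fun i : Fin n => {Sum.inl i, Sum.inr i}) (conjFamily s)) := by
  funext z
  have h1 : monomialSum (Sum.elim (fun _ : Fin n => 1) (conjCoeff t))
      (Sum.elim (fun i : Fin n => {Sum.inl i, Sum.inr i}) (conjFamily s)) z =
      ∑ i, z i * (starRingEnd ℂ) (z i) + monomialSum (conjCoeff t) (conjFamily s) z := by
    simp only [monomialSum, Fintype.sum_sum_type (α₁ := Fin n), Sum.elim_inl, Sum.elim_inr]
    congr 1
    refine Finset.sum_congr rfl fun i _ => ?_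
    rw [monomialFun, Finset.prod_pair (by simp)]
    simp [coordFun]
  rw [h1, testPotential, ← Complex.conj_eq_iff_re]
  simp only [map_add, map_sum, map_mul, Complex.conj_conj]
  congr 1
  · exact Finset.sum_congr rfl fun i _ => mul_comm _ _
  · simp only [monomialSum, map_add, map_sum, map_mul, conj_monomialFun, Fintype.sum_sum_type,
      conjCoeff, conjFamily, Sum.elim_inl, Sum.elim_inr, Complex.conj_conj, conjSet_conjSet]
    rw [add_comm]

theorem contDiff_testPotential (t : κ → ℂ) (s : κ → Finset (Idx n)) :
    ContDiff ℝ ∞ (testPotential t s) :=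
  Complex.reCLM.contDiff.comp ((ContDiff.sum fun i _ => (contDiff_coordFun (Sum.inl i)).mul
    (contDiff_coordFun (Sum.inr i))).add (contDiff_monomialSum _ _))

theorem isStable_conjFamily {κ : Type*} {s : κ → Finset (Idx n)} (hs : ∀ i, IsStable (s i).val)
    (i : κ ⊕ κ) :
    IsStable (conjFamily s i).val := by
  rcases i with i | i
  · exact hs i
  · obtain ⟨h1, h2, h3⟩ := hs i
    have e : (conjFamily s (Sum.inr i)).val = (s i).val.map Sum.swap := rfl
    rw [e]
    refine ⟨?_, ?_, by simpa using h3⟩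
    · rw [Multiset.countP_map, ← Multiset.countP_eq_card_filter]
      simpa using h2
    · rw [Multiset.countP_map, ← Multiset.countP_eq_card_filter]
      simpa using h1

theorem wirtList_testPotential (t : κ → ℂ) (s : κ → Finset (Idx n)) (l : List (Idx n))
    (hl : l.length ≠ 2) : wirtList l (fun z => (testPotential t s z : ℂ)) 0 =
      ∑ i, if (l : Multiset (Idx n)) = (conjFamily s i).val then conjCoeff t i else 0 := by
  rw [testPotential_eq, wirtList_monomialSum, Fintype.sum_sum_type]
  simp only [Sum.elim_inl, Sum.elim_inr]
  have h0 : ∀ i : Fin n, ¬ (l : Multiset (Idx n)) =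
      ({Sum.inl i, Sum.inr i} : Finset (Idx n)).val := by
    intro i h
    have := congrArg Multiset.card h
    rw [Finset.card_val, Finset.card_pair (by simp)] at this
    exact hl (by simpa using this)
  simp only [h0, if_false, Finset.sum_const_zero, zero_add]
  rfl

theorem metric_testPotential (t : κ → ℂ) {s : κ → Finset (Idx n)} (hs : ∀ i, IsStable (s i).val) :
    metric (testPotential t s) 0 = 1 := by
  ext p q
  change wirtList [Sum.inl p, Sum.inr q] (fun z => (testPotential t s z : ℂ)) 0 = _
  rw [testPotential_eq, wirtList_monomialSum, Fintype.sum_sum_type]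
  simp only [Sum.elim_inl, Sum.elim_inr]
  have h1 : ∀ i, ¬ (([Sum.inl p, Sum.inr q] : List (Idx n)) : Multiset (Idx n)) =
      (conjFamily s i).val := fun i h => by
    have h3 := (isStable_conjFamily hs i).2.2
    rw [← h] at h3
    simp at h3
  have h2 : ∀ i : Fin n, (([Sum.inl p, Sum.inr q] : List (Idx n)) : Multiset (Idx n)) =
      ({Sum.inl i, Sum.inr i} : Finset (Idx n)).val ↔ p = i ∧ q = i := by
    intro i
    rw [Finset.insert_val_of_notMem (by simp)]
    constructor
    · intro h
      have hp : (Sum.inl p : Idx n) ∈ (Sum.inl i ::ₘ ({Sum.inr i} : Finset (Idx n)).val) := by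
        rw [← h]; simp
      have hq : (Sum.inr q : Idx n) ∈ (Sum.inl i ::ₘ ({Sum.inr i} : Finset (Idx n)).val) := by
        rw [← h]; simp
      exact ⟨by simpa using hp, by simpa using hq⟩
    · rintro ⟨rfl, rfl⟩
      rfl
  simp only [h1, h2, if_false, Finset.sum_const_zero, add_zero]
  rw [Matrix.one_apply]
  by_cases hpq : p = q
  · subst hpq
    simp
  · rw [if_neg hpq]
    refine Finset.sum_eq_zero fun i _ => if_neg ?_
    rintro ⟨rfl, rfl⟩
    exact hpq rfl

/-- The phase remainder of the test potential at the origin. -/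
theorem isPhaseRemainder_testPotential (t : κ → ℂ) {s : κ → Finset (Idx n)}
    (hs : ∀ i, IsStable (s i).val) :
    IsPhaseRemainder (testPotential t s) 0
      (monomialSum (fun i => -conjCoeff t i) (conjFamily s)) where
  smooth := (contDiff_monomialSum _ _).contDiffAt
  low l hl := by
    rw [wirtList_monomialSum]
    refine Finset.sum_eq_zero fun i _ => if_neg fun h => ?_
    have h3 := (isStable_conjFamily hs i).2.2
    rw [← h] at h3
    simp at h3
    omega
  holomorphic l := by
    rw [wirtList_monomialSum]
    refine Finset.sum_eq_zero fun i _ => if_neg fun h => ?_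
    have h3 := (isStable_conjFamily hs i).2.1
    rw [← h] at h3
    obtain ⟨α, hα, hα'⟩ := Multiset.countP_pos.1 h3
    simp only [Multiset.mem_coe, List.mem_map] at hα
    obtain ⟨i, -, rfl⟩ := hα
    simp at hα'
  antiholomorphic l := by
    rw [wirtList_monomialSum]
    refine Finset.sum_eq_zero fun i _ => if_neg fun h => ?_
    have h3 := (isStable_conjFamily hs i).1
    rw [← h] at h3
    obtain ⟨α, hα, hα'⟩ := Multiset.countP_pos.1 h3
    simp only [Multiset.mem_coe, List.mem_map] at hα
    obtain ⟨i, -, rfl⟩ := hα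
    simp at hα'
  mixed l i j hl := by
    change _ = - wirtList l (wirtList [Sum.inl i, Sum.inr j]
      (fun z => (testPotential t s z : ℂ))) 0
    rw [← wirtList_append, wirtList_monomialSum, wirtList_testPotential]
    · rw [← Finset.sum_neg_distrib]
      refine Finset.sum_congr rfl fun i _ => ?_
      split_ifs <;> simp
    · have : l.length ≠ 0 := by simpa using hl
      simp
      omega

theorem wirtMultiset_testPotential (t : κ → ℂ) (s : κ → Finset (Idx n)) {m : Multiset (Idx n)}
    (hm : 3 ≤ m.card) : wirtMultiset m (fun z => (testPotential t s z : ℂ)) 0 =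
      ∑ i, if m = (conjFamily s i).val then conjCoeff t i else 0 := by
  rw [wirtMultiset, wirtList_testPotential, Multiset.coe_toList]
  simp
  omega

theorem invMetric_testPotential (t : κ → ℂ) {s : κ → Finset (Idx n)}
    (hs : ∀ i, IsStable (s i).val) (p q : Fin n) :
    invMetric (testPotential t s) 0 p q = if p = q then 1 else 0 := by
  rw [invMetric, metric_testPotential t hs, inv_one, Matrix.one_apply]
  simp only [eq_comm]

end TestPotential

/-! ### Extraction of a multilinear coefficient -/

section Extraction

/-- A primitive cube root of unity. -/
noncomputable def cubeRoot : ℂ := Complex.exp (2 * Real.pi * Complex.I / 3)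

theorem isPrimitiveRoot_cubeRoot : IsPrimitiveRoot cubeRoot 3 := by
  have := Complex.isPrimitiveRoot_exp 3 (by norm_num)
  rwa [Nat.cast_ofNat] at this

theorem conj_cubeRoot : (starRingEnd ℂ) cubeRoot = cubeRoot ^ 2 := by
  have h1 : (starRingEnd ℂ) cubeRoot = cubeRoot⁻¹ := by
    rw [Complex.inv_eq_conj]
    exact isPrimitiveRoot_cubeRoot.norm'_eq_one (by norm_num)
  rw [h1]
  refine inv_eq_of_mul_eq_one_right ?_
  rw [← pow_succ']
  exact isPrimitiveRoot_cubeRoot.pow_eq_one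

theorem cubeRoot_sum : 1 + cubeRoot + cubeRoot ^ 2 = 0 := by
  have := isPrimitiveRoot_cubeRoot.geom_sum_eq_zero (by norm_num)
  simpa [Finset.sum_range_succ] using this

/-- The value of `t` (for `false`) or `t̄` (for `true`) at `t = ω^k`. -/
noncomputable def cubeChar (k : Fin 3) (b : Bool) : ℂ :=
  if b then (starRingEnd ℂ) (cubeRoot ^ (k : ℕ)) else cubeRoot ^ (k : ℕ)

theorem sum_cubeChar : ∑ k, cubeChar k true = 0 := by
  have h := cubeRoot_sum
  have h3 := isPrimitiveRoot_cubeRoot.pow_eq_one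
  simp [Fin.sum_univ_three, cubeChar, conj_cubeRoot]
  linear_combination h + cubeRoot * h3

theorem sum_cubeChar_mul (b : Bool) :
    ∑ k, cubeChar k true * cubeChar k b = if b then 0 else 3 := by
  have h := cubeRoot_sum
  have h3 := isPrimitiveRoot_cubeRoot.pow_eq_one
  cases b
  · simp [Fin.sum_univ_three, cubeChar, conj_cubeRoot]
    linear_combination (2 + cubeRoot ^ 3) * h3
  · simp [Fin.sum_univ_three, cubeChar, conj_cubeRoot]
    linear_combination h + (cubeRoot + cubeRoot ^ 2 * (cubeRoot ^ 3 + 1)) * h3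

/-- Averaging over cube roots of unity detects the squarefree monomials: given at most as many
factors `t_w` or `t̄_w` as there are variables, the average against `∏ t̄_w` vanishes unless every
variable occurs exactly once and without conjugation. -/
theorem sum_prod_cubeChar {V W : Type*} [Fintype V] [Fintype W] [DecidableEq W]
    (hVW : Fintype.card V ≤ Fintype.card W) (p : V → W) (b : V → Bool) :
    (Function.Bijective p ∧ (∀ v, b v = false) ∧
      ∑ k : W → Fin 3, (∏ w, cubeChar (k w) true) * ∏ v, cubeChar (k (p v)) (b v) =
        3 ^ Fintype.card W) ∨
      ∑ k : W → Fin 3, (∏ w, cubeChar (k w) true) * ∏ v, cubeChar (k (p v)) (b v) = 0 := by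
  classical
  have h1 : ∑ k : W → Fin 3, (∏ w, cubeChar (k w) true) * ∏ v, cubeChar (k (p v)) (b v) =
      ∏ w, ∑ k : Fin 3, cubeChar k true * ∏ v ∈ univ.filter (fun v => p v = w),
        cubeChar k (b v) := by
    rw [Finset.prod_univ_sum, Fintype.piFinset_univ]
    refine Finset.sum_congr rfl fun k _ => ?_
    rw [Finset.prod_mul_distrib, ← Finset.prod_fiberwise univ p]
    congr 1
    refine Finset.prod_congr rfl fun w _ => Finset.prod_congr rfl fun v hv => ?_
    rw [(Finset.mem_filter.1 hv).2]
  by_cases hp : Function.Surjective p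
  · have hb : Function.Bijective p :=
      (Fintype.bijective_iff_surjective_and_card p).2
        ⟨hp, le_antisymm hVW (Fintype.card_le_of_surjective p hp)⟩
    let e := Equiv.ofBijective p hb
    have h2 : ∀ w, (univ.filter fun v => p v = w) = {e.symm w} := by
      intro w
      ext v
      simp only [Finset.mem_filter, Finset.mem_univ, true_and, Finset.mem_singleton,
        Equiv.eq_symm_apply]
      rfl
    simp only [h2, Finset.prod_singleton, sum_cubeChar_mul] at h1
    by_cases hf : ∀ v, b v = false
    · refine Or.inl ⟨hb, hf, ?_⟩
      rw [h1]
      simp [hf]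
    · right
      push Not at hf
      obtain ⟨v, hv⟩ := hf
      rw [h1]
      exact Finset.prod_eq_zero (mem_univ (e v)) (by simp [hv])
  · right
    simp only [Function.Surjective, not_forall, not_exists] at hp
    obtain ⟨w, hw⟩ := hp
    rw [h1]
    refine Finset.prod_eq_zero (mem_univ w) ?_
    rw [Finset.filter_false_of_mem fun v _ => hw v]
    simpa using sum_cubeChar

end Extraction

/-! ### Linear independence of the Weyl invariants -/

namespace PointedDigraph

/-- The half-edges at a vertex, labelled by the edges. -/
def halfSet (Γ : PointedDigraph) (v : Option (Fin Γ.numV)) : Finset (Idx Γ.numE) :=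
  (univ.filter fun e => Γ.src e = v).disjSum (univ.filter fun e => Γ.tgt e = v)

theorem halfSet_val (Γ : PointedDigraph) (v : Option (Fin Γ.numV)) :
    (Γ.halfSet v).val = Γ.halfEdges id id v := rfl

theorem isStable_halfEdges {Γ : PointedDigraph} (hΓ : Γ.IsSemistable) {n : ℕ}
    (a b : Fin Γ.numE → Fin n) (v : Fin Γ.numV) : IsStable (Γ.halfEdges a b (some v)) := by
  change IsStable (halves Γ.src Γ.tgt a b (some v))
  have := hΓ v
  rw [IsStable, countP_isLeft_halves, countP_isRight_halves, card_halves]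
  simp only [inDeg, outDeg] at this
  omega

theorem inl_mem_halfEdges (Γ : PointedDigraph) {n : ℕ} (a b : Fin Γ.numE → Fin n)
    (v : Option (Fin Γ.numV)) (i : Fin n) :
    Sum.inl i ∈ Γ.halfEdges a b v ↔ ∃ e, Γ.src e = v ∧ a e = i := by
  simp [halfEdges]

theorem inr_mem_halfEdges (Γ : PointedDigraph) {n : ℕ} (a b : Fin Γ.numE → Fin n)
    (v : Option (Fin Γ.numV)) (i : Fin n) :
    Sum.inr i ∈ Γ.halfEdges a b v ↔ ∃ e, Γ.tgt e = v ∧ b e = i := by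
  simp [halfEdges]

/-- A labelling of the edges of `Γ` by the edges of `Γ₀` that matches the half-edges at all vertices
comes from an isomorphism. -/
theorem nonempty_iso_of_halfEdges_eq {Γ Γ₀ : PointedDigraph} (hE : Γ.numE = Γ₀.numE)
    (π : Fin Γ.numV ≃ Fin Γ₀.numV) (a : Fin Γ.numE → Fin Γ₀.numE)
    (h : ∀ v : Option (Fin Γ.numV), Γ.halfEdges a a v = (Γ₀.halfSet (v.map π)).val) :
    Nonempty (Iso Γ Γ₀) := by
  have hs : Function.Surjective a := by
    intro e₀
    have h1 := h ((Equiv.optionCongr π).symm (Γ₀.src e₀))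
    have h2 : ((Equiv.optionCongr π).symm (Γ₀.src e₀)).map π = Γ₀.src e₀ :=
      (Equiv.optionCongr π).apply_symm_apply _
    rw [h2] at h1
    have h3 : (Sum.inl e₀ : Idx Γ₀.numE) ∈ (Γ₀.halfSet (Γ₀.src e₀)).val := by
      rw [halfSet_val, inl_mem_halfEdges]
      exact ⟨e₀, rfl, rfl⟩
    rw [← h1, inl_mem_halfEdges] at h3
    obtain ⟨e, -, he⟩ := h3
    exact ⟨e, he⟩
  have hb : Function.Bijective a :=
    (Fintype.bijective_iff_surjective_and_card a).2 ⟨hs, by simpa using hE⟩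
  refine ⟨⟨π, Equiv.ofBijective a hb, fun e => ?_, fun e => ?_⟩⟩
  · have h1 : (Sum.inl (a e) : Idx Γ₀.numE) ∈ Γ.halfEdges a a (Γ.src e) :=
      (inl_mem_halfEdges _ _ _ _ _).2 ⟨e, rfl, rfl⟩
    rw [h, halfSet_val, inl_mem_halfEdges] at h1
    obtain ⟨e', h2, h3⟩ := h1
    simp only [id] at h3
    rw [Equiv.ofBijective_apply, ← h3, h2]
  · have h1 : (Sum.inr (a e) : Idx Γ₀.numE) ∈ Γ.halfEdges a a (Γ.tgt e) :=
      (inr_mem_halfEdges _ _ _ _ _).2 ⟨e, rfl, rfl⟩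
    rw [h, halfSet_val, inr_mem_halfEdges] at h1
    obtain ⟨e', h2, h3⟩ := h1
    simp only [id] at h3
    rw [Equiv.ofBijective_apply, ← h3, h2]

/-- The potential that attaches to each vertex `v` of `Γ` the monomial of its half-edges, with the
coefficient `ω ^ k v`. -/
noncomputable def testΦ (Γ : PointedDigraph) (k : Fin Γ.numV → Fin 3) : (Fin Γ.numE → ℂ) → ℝ :=
  testPotential (fun v => cubeRoot ^ (k v : ℕ)) fun v : Fin Γ.numV => Γ.halfSet (some v)

theorem isStable_halfSet {Γ : PointedDigraph} (hΓ : Γ.IsSemistable) (v : Fin Γ.numV) :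
    IsStable (Γ.halfSet (some v)).val := by
  rw [halfSet_val]
  exact isStable_halfEdges hΓ _ _ v

theorem conjCoeff_eq_cubeChar {κ : Type*} (k : κ → Fin 3) (w : κ ⊕ κ) :
    conjCoeff (fun v => cubeRoot ^ (k v : ℕ)) w =
      cubeChar (k (Sum.elim id id w)) w.isRight := by
  rcases w with w | w <;> simp [conjCoeff, cubeChar]

/-- The Weyl invariants at the test potential of `Γ₀`: a sum over labellings `a` of the edges by
edges of `Γ₀` and `q` of the vertices by vertices of `Γ₀` or their conjugates. -/
theorem weyl_testΦ {Γ Γ₀ : PointedDigraph} (hΓ : Γ.IsSemistable) (hΓ₀ : Γ₀.IsSemistable)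
    (k : Fin Γ₀.numV → Fin 3) :
    Γ.weyl (Γ₀.testΦ k) (monomialFun (Γ₀.halfSet none)) 0 =
      ∑ a : Fin Γ.numE → Fin Γ₀.numE, ∑ q : Fin Γ.numV → Fin Γ₀.numV ⊕ Fin Γ₀.numV,
        if Γ.halfEdges a a none = (Γ₀.halfSet none).val ∧ ∀ v, Γ.halfEdges a a (some v) =
          (conjFamily (fun v : Fin Γ₀.numV => Γ₀.halfSet (some v)) (q v)).val
        then ∏ v, cubeChar (k (Sum.elim id id (q v))) (q v).isRight else 0 := by
  have h1 : ∀ a b : Fin Γ.numE → Fin Γ₀.numE,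
      ∏ e, invMetric (Γ₀.testΦ k) 0 (a e) (b e) = if a = b then 1 else 0 := by
    intro a b
    simp only [testΦ, invMetric_testPotential _ (isStable_halfSet hΓ₀)]
    rw [Finset.prod_ite_zero]
    simp [funext_iff]
  rw [weyl]
  refine Finset.sum_congr rfl fun a _ => ?_
  simp only [h1, ite_mul, one_mul, zero_mul]
  rw [Finset.sum_ite_eq univ a, if_pos (mem_univ _)]
  have h2 : ∀ v : Fin Γ.numV, wirtMultiset (Γ.halfEdges a a (some v))
      (fun w => (Γ₀.testΦ k w : ℂ)) 0 = ∑ w, if Γ.halfEdges a a (some v) =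
        (conjFamily (fun v : Fin Γ₀.numV => Γ₀.halfSet (some v)) w).val then
        cubeChar (k (Sum.elim id id w)) w.isRight else 0 := by
    intro v
    rw [testΦ, wirtMultiset_testPotential _ _ (isStable_halfEdges hΓ a a v).2.2]
    simp only [conjCoeff_eq_cubeChar]
  simp only [h2]
  rw [Finset.prod_univ_sum, Fintype.piFinset_univ, wirtMultiset, wirtList_monomialFun,
    Multiset.coe_toList, Finset.sum_mul]
  refine Finset.sum_congr rfl fun q _ => ?_
  rw [Finset.prod_ite_zero]
  by_cases hn : Γ.halfEdges a a none = (Γ₀.halfSet none).val <;> simp [hn]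

/-- Averaging the Weyl invariant of `Γ` over the test potentials of `Γ₀`. -/
noncomputable def testAverage (Γ₀ Γ : PointedDigraph) : ℂ :=
  ∑ k : Fin Γ₀.numV → Fin 3, (∏ w, cubeChar (k w) true) *
    Γ.weyl (Γ₀.testΦ k) (monomialFun (Γ₀.halfSet none)) 0

theorem testAverage_eq {Γ Γ₀ : PointedDigraph} (hΓ : Γ.IsSemistable) (hΓ₀ : Γ₀.IsSemistable) :
    testAverage Γ₀ Γ = ∑ a : Fin Γ.numE → Fin Γ₀.numE,
      ∑ q : Fin Γ.numV → Fin Γ₀.numV ⊕ Fin Γ₀.numV,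
        if Γ.halfEdges a a none = (Γ₀.halfSet none).val ∧ ∀ v, Γ.halfEdges a a (some v) =
          (conjFamily (fun v : Fin Γ₀.numV => Γ₀.halfSet (some v)) (q v)).val
        then ∑ k : Fin Γ₀.numV → Fin 3, (∏ w, cubeChar (k w) true) *
          ∏ v, cubeChar (k (Sum.elim id id (q v))) (q v).isRight else 0 := by
  simp only [testAverage, weyl_testΦ hΓ hΓ₀, Finset.mul_sum]
  rw [Finset.sum_comm]
  refine Finset.sum_congr rfl fun a _ => ?_
  rw [Finset.sum_comm]
  refine Finset.sum_congr rfl fun q _ => ?_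
  split_ifs <;> simp

theorem testAverage_eq_zero {Γ Γ₀ : PointedDigraph} (hΓ : Γ.IsSemistable) (hΓ₀ : Γ₀.IsSemistable)
    (hw : Γ.weight = Γ₀.weight) (hV : Γ.numV ≤ Γ₀.numV) (hne : ¬ Nonempty (Iso Γ Γ₀)) :
    testAverage Γ₀ Γ = 0 := by
  rw [testAverage_eq hΓ hΓ₀]
  refine Finset.sum_eq_zero fun a _ => Finset.sum_eq_zero fun q _ => ?_
  split_ifs with hc
  · rcases sum_prod_cubeChar (by simpa using hV) (fun v => Sum.elim id id (q v))
      (fun v => (q v).isRight) with ⟨hb, hr, -⟩ | h0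
    · exfalso
      refine hne (nonempty_iso_of_halfEdges_eq ?_ (Equiv.ofBijective _ hb) a ?_)
      · have := Fintype.card_of_bijective hb
        simp only [Fintype.card_fin] at this
        simp only [weight] at hw
        omega
      · rintro (_ | v)
        · exact hc.1
        · rw [hc.2 v]
          have hv := hr v
          rcases hq : q v with w | w
          · simp [conjFamily, hq]
          · simp [hq] at hv
    · exact h0
  · rfl

theorem testAverage_self_ne_zero {Γ : PointedDigraph} (hΓ : Γ.IsSemistable) :
    testAverage Γ Γ ≠ 0 := by
  classical
  rw [testAverage_eq hΓ hΓ]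
  have h1 : ∀ (a : Fin Γ.numE → Fin Γ.numE) (q : Fin Γ.numV → Fin Γ.numV ⊕ Fin Γ.numV),
      ∃ m : ℕ, (if Γ.halfEdges a a none = (Γ.halfSet none).val ∧ ∀ v, Γ.halfEdges a a (some v) =
          (conjFamily (fun v : Fin Γ.numV => Γ.halfSet (some v)) (q v)).val
        then ∑ k : Fin Γ.numV → Fin 3, (∏ w, cubeChar (k w) true) *
          ∏ v, cubeChar (k (Sum.elim id id (q v))) (q v).isRight else 0) = (m : ℂ) := by
    intro a q
    split_ifs
    · rcases sum_prod_cubeChar le_rfl (fun v => Sum.elim id id (q v))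
        (fun v => (q v).isRight) with ⟨-, -, h⟩ | h
      · exact ⟨3 ^ Γ.numV, by rw [h]; simp⟩
      · exact ⟨0, by rw [h]; simp⟩
    · exact ⟨0, by simp⟩
  choose m hm using h1
  have h2 : m id Sum.inl ≠ 0 := by
    have h3 := hm id Sum.inl
    rw [if_pos ⟨rfl, fun v => rfl⟩] at h3
    rcases sum_prod_cubeChar le_rfl (fun v : Fin Γ.numV => v) (fun v => false) with
      ⟨-, -, h⟩ | h
    · have h4 := h.symm.trans h3
      intro h0
      rw [h0] at h4
      simp at h4
    · exfalso
      have h5 : ∑ k : Fin Γ.numV → Fin 3, (∏ w, cubeChar (k w) true) *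
          ∏ v, cubeChar (k v) false = 3 ^ Γ.numV := by
        simp only [← Finset.prod_mul_distrib]
        have := Finset.prod_univ_sum (fun _ : Fin Γ.numV => (univ : Finset (Fin 3)))
          (fun _ x => cubeChar x true * cubeChar x false)
        rw [Fintype.piFinset_univ] at this
        rw [← this, sum_cubeChar_mul]
        simp
      rw [h] at h5
      exact pow_ne_zero _ (by norm_num) h5.symm
  simp only [hm]
  intro h0
  norm_cast at h0
  have h3 := (Finset.sum_eq_zero_iff.1 h0) id (mem_univ _)
  exact h2 ((Finset.sum_eq_zero_iff.1 h3) Sum.inl (mem_univ _))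

/-- The Weyl invariants of the semistable pointed digraphs of a given weight are linearly
independent as functions of the potential and of `f`. -/
theorem eq_zero_of_sum_weyl_eq_zero (j : ℕ) (c : IsoClass → ℂ)
    (h : ∀ (Γ : PointedDigraph) (k : Fin Γ.numV → Fin 3), Γ.IsSemistable →
      ∑ q ∈ semistableClasses j,
        c q * q.weyl (Γ.testΦ k) (monomialFun (Γ.halfSet none)) 0 = 0) :
    ∀ q ∈ semistableClasses j, c q = 0 := by
  classical
  by_contra! hne
  -- A class with as many vertices as possible among those with a nonzero coefficient.
  obtain ⟨q₀, hq₀, hmax⟩ := Finset.exists_max_image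
    ((semistableClasses j).filter fun q => c q ≠ 0) (fun q => q.out.numV)
    (by obtain ⟨q, hq, hc⟩ := hne; exact ⟨q, Finset.mem_filter.2 ⟨hq, hc⟩⟩)
  obtain ⟨hq₀, hc₀⟩ := Finset.mem_filter.1 hq₀
  have hmem : ∀ q ∈ semistableClasses j, q.out.IsSemistable ∧ q.out.weight = j := fun q hq =>
    mk_mem_semistableClasses.1 (by rwa [Quotient.out_eq])
  have hweyl : ∀ (q : IsoClass) {n : ℕ} (Φ : (Fin n → ℂ) → ℝ) (f : (Fin n → ℂ) → ℂ)
      (x : Fin n → ℂ), q.weyl Φ f x = q.out.weyl Φ f x := by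
    intro q n Φ f x
    conv_lhs => rw [← Quotient.out_eq q]
    rfl
  have h1 : ∑ q ∈ semistableClasses j, c q * testAverage q₀.out q.out = 0 := by
    have h2 : ∀ q, c q * testAverage q₀.out q.out = ∑ k : Fin q₀.out.numV → Fin 3,
        (∏ w, cubeChar (k w) true) * (c q *
          q.weyl (q₀.out.testΦ k) (monomialFun (q₀.out.halfSet none)) 0) := by
      intro q
      rw [testAverage, Finset.mul_sum]
      refine Finset.sum_congr rfl fun k _ => ?_
      rw [hweyl]
      ring
    simp only [h2]
    rw [Finset.sum_comm]
    refine Finset.sum_eq_zero fun k _ => ?_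
    rw [← Finset.mul_sum, h _ k (hmem q₀ hq₀).1, mul_zero]
  rw [Finset.sum_eq_single q₀] at h1
  · exact (mul_ne_zero hc₀ (testAverage_self_ne_zero (hmem q₀ hq₀).1)) h1
  · intro q hq hqne
    by_cases hc : c q = 0
    · rw [hc, zero_mul]
    · rw [testAverage_eq_zero (hmem q hq).1 (hmem q₀ hq₀).1
        ((hmem q hq).2.trans (hmem q₀ hq₀).2.symm) (hmax q (Finset.mem_filter.2 ⟨hq, hc⟩)),
        mul_zero]
      rintro ⟨i⟩
      refine hqne ?_
      rw [← Quotient.out_eq q, ← Quotient.out_eq q₀]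
      exact Quotient.sound ⟨i⟩
  · intro h
    exact absurd hq₀ h

end PointedDigraph

end BerezinGraph

theorem theorem3p2 (R : BerezinGraph.PointedDigraph.IsoClass → ℂ) :
    (∀ (n : ℕ) (U : Set (Fin n → ℂ)) (Φ : (Fin n → ℂ) → ℝ) (f : (Fin n → ℂ) → ℂ)
        (x : Fin n → ℂ) (S : (Fin n → ℂ) → ℂ) (j : ℕ),
        IsOpen U → x ∈ U → BerezinGraph.IsKahlerPotential Φ U → ContDiffOn ℝ ∞ f U →
        BerezinGraph.IsPhaseRemainder Φ x S →
        BerezinGraph.englisR Φ S j f x =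
          ∑ Γ ∈ BerezinGraph.PointedDigraph.semistableClasses j,
            R Γ * BerezinGraph.PointedDigraph.IsoClass.weyl Φ f x Γ) ↔
      ∀ Γ : BerezinGraph.PointedDigraph, Γ.IsSemistable →
        R ⟦Γ⟧ = ((Γ.adjMinus - 1).det : ℂ) / (Nat.card Γ.Aut : ℂ) := by
  open BerezinGraph BerezinGraph.PointedDigraph in
  have expansion : ∀ (n : ℕ) (U : Set (Fin n → ℂ)) (Φ : (Fin n → ℂ) → ℝ) (f : (Fin n → ℂ) → ℂ)
      (x : Fin n → ℂ) (S : (Fin n → ℂ) → ℂ) (j : ℕ), IsOpen U → x ∈ U →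
      IsKahlerPotential Φ U → ContDiffOn ℝ ∞ f U → IsPhaseRemainder Φ x S →
      englisR Φ S j f x = ∑ Γ ∈ semistableClasses j, Γ.coeff * Γ.weyl Φ f x := by
    intro n U Φ f x S j hU hx hΦ hf hS
    have hUx := hU.mem_nhds hx
    exact englisR_eq_sum_coeff
      (Complex.ofRealCLM.contDiff.contDiffAt.comp x (hΦ.smooth.contDiffAt hUx))
      (hf.contDiffAt hUx) hS ((Matrix.isUnit_iff_isUnit_det _).1 (hΦ.posDef x hx).isUnit) j
  open BerezinGraph BerezinGraph.PointedDigraph in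
  constructor
  · intro h Γ hΓ
    obtain ⟨j, hj⟩ : ∃ j : ℕ, Γ.weight = j := by
      have := hΓ.three_mul_numV_le
      refine Int.eq_ofNat_of_zero_le ?_
      simp only [weight]
      omega
    have key := eq_zero_of_sum_weyl_eq_zero j (fun q => R q - q.coeff) ?_ ⟦Γ⟧
      (mk_mem_semistableClasses.2 ⟨hΓ, hj⟩)
    · exact sub_eq_zero.1 key
    · intro Δ k hΔ
      have hst := isStable_halfSet hΔ
      obtain ⟨U, hU, h0, hK⟩ := exists_isKahlerPotential
        (contDiff_testPotential (fun v => cubeRoot ^ (k v : ℕ))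
          fun v : Fin Δ.numV => Δ.halfSet (some v)) (metric_testPotential _ hst)
      have hf : ContDiffOn ℝ ∞ (monomialFun (Δ.halfSet none)) U :=
        (contDiff_monomialFun _).contDiffOn
      have hS := isPhaseRemainder_testPotential (fun v => cubeRoot ^ (k v : ℕ)) hst
      have h1 := h _ U _ _ 0 _ j hU h0 hK hf hS
      have h2 := expansion _ U _ _ 0 _ j hU h0 hK hf hS
      simp only [sub_mul, Finset.sum_sub_distrib]
      exact sub_eq_zero.2 (h1.symm.trans h2)
  · intro h n U Φ f x S j hU hx hΦ hf hS
    rw [expansion n U Φ f x S j hU hx hΦ hf hS]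
    refine Finset.sum_congr rfl fun q hq => ?_
    obtain ⟨Γ, rfl⟩ := Quotient.exists_rep q
    rw [h Γ (mk_mem_semistableClasses.1 hq).1]
    rfl
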